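/- Let $\gamma$ be an oval, i.e. a smooth, simple, closed, strictly convex plane curve of length $L$, oriented counterclockwise and parametrized by arc length (extended $L$-periodically to $\mathbb{R}$). Let $k$ be its curvature, $k_{\min}$ the minimal value of $k$, and let $R>0$ satisfy $1/R<k_{\min}$. For integers $n\ge 1$ and $0<p\le n$, a curvilinear $n$-gon with rotation number $p$ inscribed in $\gamma$ is given by real parameters $x_0\le x_1\le\dots\le x_n$ with $x_{i+1}\le x_i+L$ and $x_n=x_0+pL$, whose vertices are the points $\gamma(x_i)$, together with oriented sides: the $i$-th side ($0\le i<n$) is a counterclockwise arc of a circle of radius $R$ from $\gamma(x_i)$ to $\gamma(x_{i+1})$ that is contained in the closed region bounded by $\gamma$ (when $\gamma(x_i)=\gamma(x_{i+1})$, this side is a single point). Let $P$ be the perimeter of such a curvilinear polygon (the sum of the lengths of its sides) and let $A=\frac12\oint (x\,dy-y\,dx)$ be the area enclosed by it, counted with multiplicity (i.e. weighted by the winding number). Let $M_{p,n}$ be the greatest value of $$P-\frac1R A$$ over all curvilinear $n$-gons with rotation number $p$ inscribed in $\gamma$. Then for all integers $p,q$ with $0<p<q$ the maxima $M_{p,q-1}$,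 $M_{p,q}$, $M_{p,q+1}$ exist (are attained), and $$M_{p,q-1}+M_{p,q+1}<2M_{p,q}.$$ -/

import Mathlib

open scoped ComplexConjugate ContDiff

noncomputable section

namespace MagneticBilliard

/-! The Euclidean plane is modelled by `ℂ`. -/

/-- The standard area form (determinant) of two plane vectors. -/
def cross (z w : ℂ) : ℝ := (conj z * w).im

/-- `γ` is an oval of length `L`: a smooth simple closed plane curve, parametrized by arc length
(extended `L`-periodically to the line), strictly convex and oriented counterclockwise: all points
of the curve other than `γ s` lie strictly to the left of the oriented tangent line at `γ s`. -/
structure IsOval (γ : ℝ → ℂ) (L : ℝ) : Prop where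
  length_pos : 0 < L
  smooth : ContDiff ℝ ∞ γ
  periodic : Function.Periodic γ L
  simple : Set.InjOn γ (Set.Ico 0 L)
  unit_speed : ∀ s, ‖deriv γ s‖ = 1
  strictly_convex : ∀ s t, γ t ≠ γ s → 0 < cross (deriv γ s) (γ t - γ s)

/-- The signed curvature of a plane curve parametrized by arc length. -/
def curvature (γ : ℝ → ℂ) (s : ℝ) : ℝ := cross (deriv γ s) (deriv (deriv γ) s)

/-- The minimal value of the curvature. -/
def curvatureMin (γ : ℝ → ℂ) : ℝ := ⨅ s, curvature γ s

/-- The closed convex region bounded by the oval `γ`. -/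
def table (γ : ℝ → ℂ) : Set ℂ := convexHull ℝ (Set.range γ)

/-- The counterclockwise parametrization of the circle with centre `c` and radius `R`. -/
def circlePoint (c : ℂ) (R θ : ℝ) : ℂ := c + R * Complex.exp (θ * Complex.I)

/-- A counterclockwise arc of radius `R` from `A` to `B`, possibly of length zero (if `A = B`). -/
structure CcwArc (R : ℝ) (A B : ℂ) where
  center : ℂ
  startAngle : ℝ
  endAngle : ℝ
  angle_le : startAngle ≤ endAngle
  start_eq : circlePoint center R startAngle = A
  end_eq : circlePoint center R endAngle = B

namespace CcwArc

variable {R : ℝ} {A B : ℂ}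

/-- The set of points of the arc. -/
def carrier (a : CcwArc R A B) : Set ℂ :=
  circlePoint a.center R '' Set.Icc a.startAngle a.endAngle

/-- The length of the arc. -/
def length (a : CcwArc R A B) : ℝ := R * (a.endAngle - a.startAngle)

/-- The integral of the 1-form `(x dy - y dx) / 2` along the arc. -/
def areaIntegral (a : CcwArc R A B) : ℝ :=
  (1 / 2) * ∫ θ in a.startAngle..a.endAngle,
    cross (circlePoint a.center R θ) (deriv (circlePoint a.center R) θ)

end CcwArc

/-- A curvilinear `q`-gon with rotation number `p` inscribed in the oval `γ` of length `L`: the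
vertices are `γ (x 0), …, γ (x q) = γ (x 0)`, where the lifted arc length parameters advance by an
amount in `[0, L]` at each step and by `p * L` altogether, and the sides are counterclockwise arcs
of radius `R` contained in the region bounded by `γ`. -/
structure InscribedPolygon (γ : ℝ → ℂ) (L R : ℝ) (p q : ℕ) where
  x : Fin (q + 1) → ℝ
  step_nonneg : ∀ i : Fin q, x i.castSucc ≤ x i.succ
  step_le : ∀ i : Fin q, x i.succ ≤ x i.castSucc + L
  closes : x (Fin.last q) = x 0 + p * L
  side : ∀ i : Fin q, CcwArc R (γ (x i.castSucc)) (γ (x i.succ))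
  side_subset : ∀ i : Fin q, (side i).carrier ⊆ table γ

namespace InscribedPolygon

variable {γ : ℝ → ℂ} {L R : ℝ} {p q : ℕ}

/-- The perimeter of the polygon. -/
def perimeter (P : InscribedPolygon γ L R p q) : ℝ := ∑ i, (P.side i).length

/-- The area enclosed by the polygon (counted with multiplicity, i.e. with winding numbers):
the integral of `(x dy - y dx) / 2` along its closed boundary curve. -/
def enclosedArea (P : InscribedPolygon γ L R p q) : ℝ := ∑ i, (P.side i).areaIntegral

end InscribedPolygon

/-- The values of `perimeter - (1 / R) * area` on the inscribed curvilinear `q`-gons with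
rotation number `p`. -/
def actionValues (γ : ℝ → ℂ) (L R : ℝ) (p q : ℕ) : Set ℝ :=
  Set.range fun P : InscribedPolygon γ L R p q => P.perimeter - 1 / R * P.enclosedArea

/-- The number `M_{p,q}`. -/
def M (γ : ℝ → ℂ) (L R : ℝ) (p q : ℕ) : ℝ := sSup (actionValues γ L R p q)

end MagneticBilliard

end

/-! Each side admitted by the hypotheses is the short arc determined by its ends. Hence the
functional is a sum of terms `generating γ R (x i) (x (i + 1))`, and the geometry is needed only to
verify `IsTwistGenerating`. Blaschke's rolling theorem (`normSq_lt`) says that the oval lies in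
every disk of radius `R` tangent to it from inside. So sides of angle less than π exist, stay in the
table and meet the oval transversally. The mixed derivative of the generating function is a positive
multiple of the product of the sines of the two angles between side and oval, which gives strict
supermodularity: exchanging the ends of two nested steps increases the action.

The inequality is then an Aubry-type exchange argument. Let `x` and `y` be maximizers with `q - 1`
and `q + 1` steps. Since `x` advances faster on average, a step of `x` contains a step of `y` after
a translation. Exchanging their ends joins the two into one closed sequence with `2 * q` steps and
rotation number `2 * p` (`exists_join`). That sequence crosses its own shift by `q` steps, so it
splits without loss into two sequences of type `(p, q)` (`exists_split`). This proves the weak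
inequality, and the strict one unless `x` and `y` share a vertex. If they share one and equality
holds, the joined sequence is itself a maximizer having two consecutive vertices in common with `y`.
The critical point equation then forces the next vertices of `x` and `y` to agree, and so on
forever, contradicting their different mean speeds. -/

namespace MagneticBilliard

/-! ### The variational argument for an abstract twist generating function. -/

/-- The properties of the generating function of an area preserving twist map that are used in
the variational argument: continuity, periodicity, vanishing on degenerate steps, strict
supermodularity, and uniqueness of the continuation of a critical segment. -/
structure IsTwistGenerating (H : ℝ → ℝ → ℝ) (L : ℝ) : Prop where
  pos : 0 < L
  cont : Continuous fun z : ℝ × ℝ => H z.1 z.2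
  periodic : ∀ s t, H (s + L) (t + L) = H s t
  diag : ∀ s, H s s = 0
  diag_add : ∀ s, H s (s + L) = 0
  super : ∀ s s' t t', s < s' → s' ≤ t → t < t' → t' ≤ s + L →
    H s t' + H s' t < H s t + H s' t'
  unique : ∀ a b c c', a < b → b < a + L → b < c → c < b + L → b < c' → c' < b + L →
    IsLocalMax (fun τ => H a τ + H τ c) b → IsLocalMax (fun τ => H a τ + H τ c') b → c = c'

/-- A finite sequence of parameters with `n` steps in `[0, L]` and total advance `p * L`. -/
structure IsPath (L : ℝ) (p n : ℕ) (x : ℕ → ℝ) : Prop where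
  le : ∀ i < n, x i ≤ x (i + 1)
  le_add : ∀ i < n, x (i + 1) ≤ x i + L
  closes : x n = x 0 + p * L

/-- An infinite sequence of parameters with steps in `[0, L]` advancing by `p * L` after `n`
steps. -/
structure IsConfig (L : ℝ) (p n : ℕ) (x : ℕ → ℝ) : Prop where
  le : ∀ i, x i ≤ x (i + 1)
  le_add : ∀ i, x (i + 1) ≤ x i + L
  closes : ∀ i, x (i + n) = x i + p * L

/-- The sum of the values of `H` along the first `n` steps. -/
def action (H : ℝ → ℝ → ℝ) (n : ℕ) (x : ℕ → ℝ) : ℝ :=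
  ∑ i ∈ Finset.range n, H (x i) (x (i + 1))

/-- A configuration with the greatest action. -/
def IsMaximizer (H : ℝ → ℝ → ℝ) (L : ℝ) (p n : ℕ) (x : ℕ → ℝ) : Prop :=
  IsConfig L p n x ∧ ∀ y, IsPath L p n y → action H n y ≤ action H n x

variable {H : ℝ → ℝ → ℝ} {L : ℝ} {p n : ℕ} {x y : ℕ → ℝ}

theorem IsConfig.isPath (h : IsConfig L p n x) : IsPath L p n x :=
  ⟨fun i _ => h.le i, fun i _ => h.le_add i, by simpa using h.closes 0⟩

theorem IsConfig.shift (h : IsConfig L p n x) (k : ℕ) : IsConfig L p n fun i => x (i + k) := by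
  refine ⟨fun i => ?_, fun i => ?_, fun i => ?_⟩
  · simpa [add_right_comm] using h.le (i + k)
  · simpa [add_right_comm] using h.le_add (i + k)
  · simpa [add_right_comm] using h.closes (i + k)

theorem IsConfig.add_const (h : IsConfig L p n x) (c : ℝ) : IsConfig L p n fun i => x i + c := by
  refine ⟨fun i => ?_, fun i => ?_, fun i => ?_⟩
  · simpa using h.le i
  · have := h.le_add i
    linarith
  · have := h.closes i
    linarith

theorem IsConfig.closes_mul (h : IsConfig L p n x) (k : ℕ) : x (k * n) = x 0 + k * (p * L) := by
  induction k with
  | zero => simp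
  | succ k ih =>
    have h1 := h.closes (k * n)
    have h2 : (k + 1) * n = k * n + n := by ring
    rw [h2, h1, ih]
    push_cast
    ring

/-- Quasi-periodic extension; it allows any vertex to be moved to index 0 by a shift. -/
theorem IsPath.exists_isConfig (hn : 0 < n) (h : IsPath L p n x) :
    ∃ y, IsConfig L p n y ∧ ∀ i ≤ n, y i = x i := by
  have key : ∀ i, ∀ r < n, x ((i * n + r + 1) % n) + ((i * n + r + 1) / n : ℕ) * (p * L)
      = x (r + 1) + i * (p * L) := by
    intro i r hr
    -- The second case `r + 1 = n` is the passage to the next period, where `closes` enters.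
    rcases Nat.lt_or_ge (r + 1) n with h1 | h1
    · rw [add_assoc, mul_comm, Nat.mul_add_mod, Nat.mul_add_div hn, Nat.mod_eq_of_lt h1,
        Nat.div_eq_of_lt h1, add_zero]
    · obtain rfl : n = r + 1 := by omega
      have h2 : i * (r + 1) + r + 1 = (r + 1) * (i + 1) := by ring
      rw [h2, Nat.mul_mod_right, Nat.mul_div_cancel_left _ hn, h.closes]
      push_cast
      ring
  have split : ∀ i, ∃ k, ∃ r < n, i = k * n + r := fun i =>
    ⟨i / n, i % n, Nat.mod_lt _ hn, by rw [mul_comm]; exact (Nat.div_add_mod i n).symm⟩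
  have val : ∀ i, ∀ r < n, x ((i * n + r) % n) + ((i * n + r) / n : ℕ) * (p * L)
      = x r + i * (p * L) := by
    intro i r hr
    rw [mul_comm, Nat.mul_add_mod, Nat.mul_add_div hn, Nat.mod_eq_of_lt hr,
        Nat.div_eq_of_lt hr, add_zero]
  refine ⟨fun i => x (i % n) + (i / n : ℕ) * (p * L), ⟨fun i => ?_, fun i => ?_, fun i => ?_⟩, ?_⟩
  · obtain ⟨k, r, hr, rfl⟩ := split i
    simp only [key k r hr, val k r hr]
    linarith [h.le r hr]
  · obtain ⟨k, r, hr, rfl⟩ := split i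
    simp only [key k r hr, val k r hr]
    linarith [h.le_add r hr]
  · simp only [Nat.add_mod_right, Nat.add_div_right _ hn]
    push_cast
    ring
  · intro i hi
    rcases hi.lt_or_eq with h1 | rfl
    · simp [Nat.mod_eq_of_lt h1, Nat.div_eq_of_lt h1]
    · simp [Nat.div_self hn, h.closes]

theorem action_congr (h : ∀ i ≤ n, x i = y i) : action H n x = action H n y :=
  Finset.sum_congr rfl fun i hi => by
    have hi := Finset.mem_range.1 hi
    rw [h i hi.le, h (i + 1) hi]

namespace IsTwistGenerating

variable (hH : IsTwistGenerating H L)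

include hH

theorem periodic_mul (k : ℕ) (s t : ℝ) : H (s + k * L) (t + k * L) = H s t := by
  induction k with
  | zero => simp
  | succ k ih =>
    rw [← ih, ← hH.periodic (s + k * L)]
    push_cast
    congr 1 <;> ring

theorem super_le {s s' t t' : ℝ} (h1 : s ≤ s') (h2 : s' ≤ t) (h3 : t ≤ t') (h4 : t' ≤ s + L) :
    H s t' + H s' t ≤ H s t + H s' t' := by
  rcases h1.eq_or_lt with rfl | h1
  · exact (add_comm _ _).le
  rcases h3.eq_or_lt with rfl | h3
  · exact le_rfl
  exact (hH.super s s' t t' h1 h2 h3 h4).le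

theorem action_shift (h : IsConfig L p n x) (k : ℕ) :
    action H n (fun i => x (i + k)) = action H n x := by
  induction k with
  | zero => rfl
  | succ k ih =>
    rw [← ih]
    have h1 := (Finset.sum_range_succ (fun i => H (x (i + k)) (x (i + 1 + k))) n).symm.trans
      (Finset.sum_range_succ' (fun i => H (x (i + k)) (x (i + 1 + k))) n)
    have h2 : H (x (n + k)) (x (n + 1 + k)) = H (x (0 + k)) (x (0 + 1 + k)) := by
      have h3 := h.closes k
      have h4 := h.closes (k + 1)
      rw [show n + k = k + n by ring, show n + 1 + k = k + 1 + n by ring, h3, h4,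
        hH.periodic_mul, zero_add, show 0 + 1 + k = k + 1 by ring]
    rw [h2] at h1
    have h3 := add_right_cancel h1
    simp only [action]
    rw [h3]
    exact Finset.sum_congr rfl fun i _ => by ring_nf

theorem action_add_mul (k : ℕ) : action H n (fun i => x i + k * L) = action H n x :=
  Finset.sum_congr rfl fun _ _ => hH.periodic_mul k _ _

theorem isMaximizer_shift (h : IsMaximizer H L p n x) (k : ℕ) :
    IsMaximizer H L p n fun i => x (i + k) :=
  ⟨h.1.shift k, fun y hy => (h.2 y hy).trans (hH.action_shift h.1 k).ge⟩

theorem isMaximizer_add_mul (h : IsMaximizer H L p n x) (k : ℕ) :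
    IsMaximizer H L p n fun i => x i + k * L :=
  ⟨h.1.add_const _, fun y hy => (h.2 y hy).trans (hH.action_add_mul k).ge⟩

/-- A maximizer cannot be improved by moving a single vertex. -/
theorem vertex_le (hn : 2 ≤ n) (h : IsMaximizer H L p n x) (i : ℕ) {τ : ℝ}
    (h1 : x i ≤ τ) (h2 : τ ≤ x i + L) (h3 : τ ≤ x (i + 2)) (h4 : x (i + 2) ≤ τ + L) :
    H (x i) τ + H τ (x (i + 2)) ≤ H (x i) (x (i + 1)) + H (x (i + 1)) (x (i + 2)) := by
  obtain ⟨m, rfl⟩ : ∃ m, n = m + 2 := ⟨n - 2, by omega⟩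
  have hx := hH.isMaximizer_shift h i
  set z : ℕ → ℝ := fun j => x (j + i) with hz
  have e0 : x i = z 0 := by simp [hz]
  have e1 : x (i + 1) = z 1 := by simp [hz, add_comm]
  have e2 : x (i + 2) = z 2 := by simp [hz, add_comm]
  rw [e0] at h1 h2
  rw [e2] at h3 h4
  rw [e0, e1, e2]
  clear_value z
  -- With at least two steps, index 1 is not the last one, so the closing condition is untouched.
  have hpath : IsPath L p (m + 2) (Function.update z 1 τ) := by
    refine ⟨fun j _ => ?_, fun j _ => ?_, ?_⟩
    · match j with
      | 0 => simpa using h1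
      | 1 => simpa using h3
      | j + 2 => simpa [Function.update] using hx.1.le (j + 2)
    · match j with
      | 0 => simpa using h2
      | 1 => simpa using h4
      | j + 2 => simpa [Function.update] using hx.1.le_add (j + 2)
    · simpa [Function.update] using hx.1.isPath.closes
  have := hx.2 _ hpath
  simp only [action, Finset.sum_range_succ'] at this
  simp [Function.update] at this
  linarith

/-- A zero step followed by a nonzero one could be improved by moving the middle vertex to the
midpoint. So zero steps propagate, and the total advance would vanish. -/
theorem not_zero_step (hp : 0 < p) (hpn : p < n) (h : IsMaximizer H L p n x) (i : ℕ) :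
    x i < x (i + 1) := by
  refine (h.1.le i).lt_of_ne fun h0 => ?_
  have step : ∀ j, x j = x (j + 1) → x (j + 1) = x (j + 2) := by
    intro j hj
    by_contra hne
    have hlt := lt_of_le_of_ne (h.1.le (j + 1)) hne
    have hle := h.1.le_add (j + 1)
    rw [show j + 1 + 1 = j + 2 by rfl] at hle hlt
    rw [← hj] at hlt hle
    have h1 := hH.vertex_le (by omega) h j (τ := (x j + x (j + 2)) / 2)
      (by linarith) (by linarith) (by linarith) (by linarith)
    have h2 := hH.super (x j) ((x j + x (j + 2)) / 2) ((x j + x (j + 2)) / 2) (x (j + 2))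
      (by linarith) le_rfl (by linarith) hle
    rw [hH.diag] at h2
    rw [← hj, hH.diag] at h1
    linarith
  have all : ∀ k, x (i + k) = x i ∧ x (i + k) = x (i + k + 1) := by
    intro k
    induction k with
    | zero => exact ⟨rfl, h0⟩
    | succ k ih => exact ⟨ih.2.symm.trans ih.1, step _ ih.2⟩
  have h1 := h.1.closes i
  rw [(all n).1] at h1
  have : 0 < (p : ℝ) * L := mul_pos (by exact_mod_cast hp) hH.pos
  linarith

/-- The mirror image of `not_zero_step`: full steps propagate, and `n` of them advance by `n * L`,
more than `p * L`. -/
theorem not_full_step (hp : 0 < p) (hpn : p < n) (h : IsMaximizer H L p n x) (i : ℕ) :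
    x (i + 1) < x i + L := by
  refine (h.1.le_add i).lt_of_ne fun h0 => ?_
  have hL := hH.pos
  have step : ∀ j, x (j + 1) = x j + L → x (j + 2) = x (j + 1) + L := by
    intro j hj
    by_contra hne
    have hlt := lt_of_le_of_ne (h.1.le_add (j + 1)) hne
    have hle := h.1.le (j + 1)
    rw [show j + 1 + 1 = j + 2 by rfl] at hle hlt
    rw [hj] at hlt hle
    obtain ⟨τ, hτ1, hτ2⟩ := exists_between (show x (j + 2) - L < x j + L by linarith)
    have h1 := hH.vertex_le (by omega) h j (τ := τ)
      (by linarith) (by linarith) (by linarith) (by linarith)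
    have h2 := hH.super (τ - L) (x j) (x (j + 2) - L) τ
      (by linarith) (by linarith) hτ1 (by linarith)
    have h3 := hH.diag_add (τ - L)
    have h4 := hH.periodic (τ - L) (x (j + 2) - L)
    have h5 := hH.periodic (x j) (x (j + 2) - L)
    rw [sub_add_cancel] at h3 h4 h5
    rw [sub_add_cancel] at h4
    rw [h3] at h2
    rw [hj, hH.diag_add, h5] at h1
    linarith
  have all : ∀ k : ℕ, x (i + k) = x i + k * L ∧ x (i + k + 1) = x (i + k) + L := by
    intro k
    induction k with
    | zero => exact ⟨by simp, h0⟩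
    | succ k ih =>
      refine ⟨?_, step _ ih.2⟩
      rw [← add_assoc, ih.2, ih.1]
      push_cast
      ring
  have h1 := h.1.closes i
  rw [(all n).1] at h1
  have : (p : ℝ) * L < n * L := mul_lt_mul_of_pos_right (by exact_mod_cast hpn) hL
  linarith

theorem isLocalMax_vertex (hp : 0 < p) (hpn : p < n) (h : IsMaximizer H L p n x) (i : ℕ) :
    IsLocalMax (fun τ => H (x i) τ + H τ (x (i + 2))) (x (i + 1)) := by
  have h1 := hH.not_zero_step hp hpn h i
  have h2 := hH.not_full_step hp hpn h i
  have h3 := hH.not_zero_step hp hpn h (i + 1)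
  have h4 := hH.not_full_step hp hpn h (i + 1)
  have h5 : max (x i) (x (i + 2) - L) < x (i + 1) := max_lt h1 (by linarith)
  have h6 : x (i + 1) < min (x i + L) (x (i + 2)) := lt_min h2 h3
  filter_upwards [Ioo_mem_nhds h5 h6] with τ hτ
  obtain ⟨h7, h8⟩ := max_lt_iff.1 hτ.1
  obtain ⟨h9, h10⟩ := lt_min_iff.1 hτ.2
  exact hH.vertex_le (by omega) h i h7.le h9.le h10.le (by linarith)

/-- Two closed sequences can be joined to one by exchanging the ends of their first steps. -/
theorem exists_join {p₁ p₂ n₁ n₂ : ℕ} (hn₁ : 0 < n₁) (hn₂ : 0 < n₂) (hx : IsConfig L p₁ n₁ x)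
    (hy : IsConfig L p₂ n₂ y) (h1 : x 0 ≤ y 1) (h2 : y 1 ≤ x 0 + L) (h3 : y 0 ≤ x 1)
    (h4 : x 1 ≤ y 0 + L) :
    ∃ z, IsPath L (p₁ + p₂) (n₁ + n₂) z ∧ (∀ i, 0 < i → i ≤ n₂ → z i = y i) ∧
      z (n₂ + 1) = x 1 + p₂ * L ∧
      action H (n₁ + n₂) z + (H (x 0) (x 1) + H (y 0) (y 1)) =
        action H n₁ x + action H n₂ y + (H (x 0) (y 1) + H (y 0) (x 1)) := by
  obtain ⟨m₁, rfl⟩ : ∃ m, n₁ = m + 1 := ⟨n₁ - 1, by omega⟩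
  obtain ⟨m₂, rfl⟩ : ∃ m, n₂ = m + 1 := ⟨n₂ - 1, by omega⟩
  have hyc := hy.isPath.closes
  -- The sequence leaves `x 0` for `y 1`, follows `y` to `y n₂ = y 0 + p₂ * L`, then jumps to `x 1 +
  -- p₂ * L` and follows the translate of `x`.
  set z : ℕ → ℝ := fun i => if i = 0 then x 0 else if i ≤ m₂ + 1 then y i else
    x (i - (m₂ + 1)) + p₂ * L with hz
  have z0 : z 0 = x 0 := by simp [hz]
  have zy : ∀ i, 0 < i → i ≤ m₂ + 1 → z i = y i := fun i hi hi' => by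
    simp [hz, hi.ne', hi']
  have zx : ∀ i, z (m₂ + 1 + (i + 1)) = x (i + 1) + p₂ * L := fun i => by
    simp [hz]
  have zx' : ∀ i, z (m₂ + 1 + (i + 1) + 1) = x (i + 1 + 1) + p₂ * L := fun i => zx (i + 1)
  have cases : ∀ i, i = 0 ∨ (∃ j < m₂, i = j + 1) ∨ i = m₂ + 1 ∨ ∃ j, i = m₂ + 1 + (j + 1) := by
    intro i
    rcases Nat.eq_zero_or_pos i with h | h
    · exact .inl h
    rcases lt_trichotomy i (m₂ + 1) with h' | h' | h'
    · exact .inr (.inl ⟨i - 1, by omega, by omega⟩)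
    · exact .inr (.inr (.inl h'))
    · exact .inr (.inr (.inr ⟨i - (m₂ + 1) - 1, by omega⟩))
  refine ⟨z, ⟨fun i _ => ?_, fun i _ => ?_, ?_⟩, zy, zx 0, ?_⟩
  · rcases cases i with rfl | ⟨j, hj, rfl⟩ | rfl | ⟨j, rfl⟩
    · rw [z0, zy _ (by omega) (by omega)]
      exact h1
    · rw [zy _ (by omega) (by omega), zy _ (by omega) (by omega)]
      exact hy.le _
    · rw [zx 0, zy _ (by omega) (by omega), hyc]
      simpa using h3
    · rw [zx j, zx' j]
      linarith [hx.le (j + 1)]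
  · rcases cases i with rfl | ⟨j, hj, rfl⟩ | rfl | ⟨j, rfl⟩
    · rw [z0, zy _ (by omega) (by omega)]
      exact h2
    · rw [zy _ (by omega) (by omega), zy _ (by omega) (by omega)]
      exact hy.le_add _
    · rw [zx 0, zy _ (by omega) (by omega), hyc]
      simp only [zero_add]
      linarith
    · rw [zx j, zx' j]
      linarith [hx.le_add (j + 1)]
  · rw [add_comm (m₁ + 1), zx, z0, hx.isPath.closes]
    push_cast
    ring
  · have e1 : action H (m₂ + 1) z + H (y 0) (y 1) = action H (m₂ + 1) y + H (x 0) (y 1) := by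
      simp only [action, Finset.sum_range_succ']
      rw [z0, zero_add, zy 1 (by omega) (by omega)]
      have : ∑ k ∈ Finset.range m₂, H (z (k + 1)) (z (k + 1 + 1)) =
          ∑ k ∈ Finset.range m₂, H (y (k + 1)) (y (k + 1 + 1)) :=
        Finset.sum_congr rfl fun i hi => by
          have := Finset.mem_range.1 hi
          rw [zy _ (by omega) (by omega), zy _ (by omega) (by omega)]
      rw [this]
      ring
    have e2 : action H (m₁ + 1) (fun i => z (m₂ + 1 + i)) + H (x 0) (x 1) =
        action H (m₁ + 1) x + H (y 0) (x 1) := by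
      simp only [action, Finset.sum_range_succ']
      simp only [zx, hH.periodic_mul, add_zero]
      rw [zy (m₂ + 1) (by omega) (by omega), hyc, hH.periodic_mul, zero_add]
      ring
    have e3 : action H (m₁ + 1 + (m₂ + 1)) z =
        action H (m₂ + 1) z + action H (m₁ + 1) (fun i => z (m₂ + 1 + i)) := by
      rw [add_comm (m₁ + 1)]
      exact Finset.sum_range_add _ _ _
    linarith

/-- A closed sequence with `2 * n` steps and rotation number `2 * p` has at most the action of
two closed sequences with `n` steps and rotation number `p`. -/
theorem exists_split {z : ℕ → ℝ} (hn : 0 < n) (hz : IsConfig L (p + p) (n + n) z) :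
    ∃ u v, IsPath L p n u ∧ IsPath L p n v ∧
      action H (n + n) z ≤ action H n u + action H n v := by
  have hp2 : ∀ i, z (i + n + n) = z i + p * L + p * L := fun i => by
    rw [add_assoc, hz.closes]
    push_cast
    ring
  -- The difference `z (i + n) - z i - p * L` changes sign when `i` grows by `n`, so somewhere it
  -- passes from nonpositive to nonnegative.
  have crossing : ∃ i, z (i + n) ≤ z i + p * L ∧ z (i + 1) + p * L ≤ z (i + 1 + n) := by
    have aux : ∀ j, z (j + n) ≤ z j + p * L → z (j + n) + p * L ≤ z (j + n + n) →
        ∃ i, z (i + n) ≤ z i + p * L ∧ z (i + 1) + p * L ≤ z (i + 1 + n) := by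
      intro j h1 h2
      by_contra! hcon
      have : ∀ k, z (j + k + n) ≤ z (j + k) + p * L := by
        intro k
        induction k with
        | zero => exact h1
        | succ k ih => exact (hcon _ ih).le
      have h3 := hcon (j + (n - 1)) (this _)
      rw [show j + (n - 1) + 1 = j + n by omega] at h3
      linarith
    rcases le_total (z n) (z 0 + p * L) with h | h
    · refine aux 0 (by simpa using h) ?_
      have := hp2 0
      simp only [zero_add] at this ⊢
      linarith
    · have h2 := hp2 0
      have h3 := hp2 n
      simp only [zero_add] at h2
      refine aux n (by linarith) (by linarith)
  obtain ⟨i, hi1, hi2⟩ := crossing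
  have hact := hH.action_shift hz i
  replace hz := hz.shift i
  replace hp2 : ∀ j, z (j + i + n + n) = z (j + i) + p * L + p * L := fun j => hp2 (j + i)
  set w : ℕ → ℝ := fun j => z (j + i) with hw
  rw [← hact]
  replace hp2 : ∀ j, w (j + n + n) = w j + p * L + p * L := fun j => by
    rw [← hp2 j]
    simp only [hw]
    congr 1
    ring
  replace hi1 : w n ≤ w 0 + p * L := by simpa [hw, add_comm] using hi1
  replace hi2 : w 1 + p * L ≤ w (n + 1) := by
    have e : n + 1 + i = i + 1 + n := by ring
    simpa [hw, e, add_comm 1 i] using hi2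
  clear_value w
  clear hact
  have h0 := hp2 0
  have h1 := hp2 1
  rw [zero_add] at h0
  obtain ⟨m, rfl⟩ : ∃ m, n = m + 1 := ⟨n - 1, by omega⟩
  have hle0 := hz.le 0
  have hlem := hz.le_add (m + 1)
  have hle0' : w 0 ≤ w 1 := hle0
  -- The pieces `w 1, …, w n` and `w (n + 1), …, w (2 * n)`, each closed up by a translate of its
  -- own first vertex.
  refine ⟨fun j => if j ≤ m then w (j + 1) else w 1 + p * L,
    fun j => if j ≤ m then w (j + (m + 2)) else w (m + 2) + p * L,
    ⟨fun j hj => ?_, fun j hj => ?_, by simp⟩, ⟨fun j hj => ?_, fun j hj => ?_, by simp⟩, ?_⟩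
  · rcases (Nat.lt_succ_iff.1 hj).lt_or_eq with h | rfl
    · simp [h.le, Nat.succ_le_of_lt h, hz.le]
    · simp
      linarith
  · rcases (Nat.lt_succ_iff.1 hj).lt_or_eq with h | rfl
    · simp [h.le, Nat.succ_le_of_lt h, hz.le_add]
    · simp
      linarith
  · rcases (Nat.lt_succ_iff.1 hj).lt_or_eq with h | rfl
    · have := hz.le (j + (m + 2))
      simpa [h.le, Nat.succ_le_of_lt h, add_right_comm] using this
    · have e : j + (j + 2) = j + 1 + (j + 1) := by ring
      simp [e, h0]
      linarith
  · rcases (Nat.lt_succ_iff.1 hj).lt_or_eq with h | rfl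
    · have := hz.le_add (j + (m + 2))
      simpa [h.le, Nat.succ_le_of_lt h, add_right_comm] using this
    · have e : j + (j + 2) = j + 1 + (j + 1) := by ring
      simp [e, h0]
      linarith
  · have hs := hH.action_shift hz 1
    rw [← hs]
    have e3 : action H (m + 1 + (m + 1)) (fun j => w (j + 1)) =
        action H (m + 1) (fun j => w (j + 1)) + action H (m + 1) (fun j => w (j + (m + 2))) := by
      simp only [action]
      rw [Finset.sum_range_add]
      congr 1
      refine Finset.sum_congr rfl fun j _ => ?_
      congr 2 <;> ring
    rw [e3]
    simp only [action, Finset.sum_range_succ]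
    have a1 : ∑ j ∈ Finset.range m, H (if j ≤ m then w (j + 1) else w 1 + p * L)
        (if j + 1 ≤ m then w (j + 1 + 1) else w 1 + p * L) =
        ∑ j ∈ Finset.range m, H (w (j + 1)) (w (j + 1 + 1)) :=
      Finset.sum_congr rfl fun j hj => by
        have := Finset.mem_range.1 hj
        rw [if_pos this.le, if_pos (Nat.succ_le_of_lt this)]
    have a2 : ∑ j ∈ Finset.range m, H (if j ≤ m then w (j + (m + 2)) else w (m + 2) + p * L)
        (if j + 1 ≤ m then w (j + 1 + (m + 2)) else w (m + 2) + p * L) =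
        ∑ j ∈ Finset.range m, H (w (j + (m + 2))) (w (j + 1 + (m + 2))) :=
      Finset.sum_congr rfl fun j hj => by
        have := Finset.mem_range.1 hj
        rw [if_pos this.le, if_pos (Nat.succ_le_of_lt this)]
    rw [a1, a2]
    have b1 : w (m + (m + 2)) = w 0 + p * L + p * L := by
      rw [← h0]; congr 1; ring
    have b2 : w (m + 1 + (m + 2)) = w 1 + p * L + p * L := by
      rw [← h1]; congr 1; ring
    have b3 := hH.periodic_mul p (w 0 + p * L) (w 1 + p * L)
    have b4 := hH.periodic_mul p (w 0 + p * L) (w (m + 2))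
    simp only [le_refl, if_true, Nat.succ_le_iff, lt_irrefl, if_false, b1, b2, b3, b4]
    -- The two steps cut are, up to translation, `w n → w (n + 1)` and `w 0 + p * L → w 1 + p * L`.
    -- They are nested, so exchanging ends does not decrease the action.
    have := hH.super_le hi1 (by linarith : w 0 + p * L ≤ w 1 + p * L) hi2 hlem
    linarith

/-- Without a crossing `x` would stay behind `y` forever, although its mean advance `p * L / n₁` is
larger. The two are compared at a common multiple of `n₁` and `n₂`. -/
theorem exists_crossing {n₁ n₂ : ℕ} (hp : 0 < p) (hlt : n₁ < n₂)
    (hx : IsConfig L p n₁ x) (hy : IsConfig L p n₂ y) (h0 : x 0 ≤ y 0) :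
    ∃ i, x i ≤ y i ∧ y (i + 1) ≤ x (i + 1) := by
  by_contra! hcon
  have hall : ∀ i, x i ≤ y i := by
    intro i
    induction i with
    | zero => exact h0
    | succ i ih => exact (hcon i ih).le
  have hpL : 0 < (p : ℝ) * L := mul_pos (by exact_mod_cast hp) hH.pos
  obtain ⟨N, hN⟩ := exists_nat_gt ((y 0 - x 0) / (p * L))
  rw [div_lt_iff₀ hpL] at hN
  have h1 := hx.closes_mul (N * n₂)
  have h2 := hy.closes_mul (N * n₁)
  have h3 : N * n₁ * n₂ = N * n₂ * n₁ := by ring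
  have h4 := hall (N * n₂ * n₁)
  rw [h1, ← h3, h2] at h4
  push_cast at h4
  have h5 : (n₁ : ℝ) + 1 ≤ n₂ := by exact_mod_cast hlt
  have h6 : (N : ℝ) * n₁ * (p * L) + N * (p * L) ≤ N * n₂ * (p * L) := by
    have := mul_le_mul_of_nonneg_left h5 (mul_nonneg (Nat.cast_nonneg N) hpL.le)
    linarith
  linarith

/-- Strict concavity of the greatest action as a function of the number of steps. -/
theorem action_add_lt {q : ℕ} (hp : 0 < p) (hpq : p < q) {w : ℕ → ℝ}
    (hx : IsMaximizer H L p (q - 1) x) (hw : IsMaximizer H L p q w)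
    (hy : IsMaximizer H L p (q + 1) y) :
    action H (q - 1) x + action H (q + 1) y < 2 * action H q w := by
  have hL := hH.pos
  by_contra! hcon
  have hdouble : ∀ z, IsPath L (p + p) (q - 1 + (q + 1)) z →
      action H (q - 1 + (q + 1)) z ≤ 2 * action H q w := by
    intro z hz
    rw [show q - 1 + (q + 1) = q + q by omega] at *
    obtain ⟨z', hz', hzz⟩ := hz.exists_isConfig (by omega)
    rw [← action_congr hzz]
    obtain ⟨u, v, hu, hv, huv⟩ := hH.exists_split (by omega) hz'
    linarith [hw.2 u hu, hw.2 v hv]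
  -- The equality case. Interior steps are needed only for `y` and for the joined sequence, since
  -- `x` may consist of full steps when `p = q - 1`.
  have step : ∀ x y, IsMaximizer H L p (q - 1) x → IsMaximizer H L p (q + 1) y →
      2 * action H q w ≤ action H (q - 1) x + action H (q + 1) y → x 0 = y 0 → x 1 = y 1 := by
    intro x y hx hy hcon h0
    have a1 := hx.1.le 0
    have a2 := hx.1.le_add 0
    have a3 := hy.1.le 0
    have a4 := hy.1.le_add 0
    simp only [zero_add] at a1 a2 a3 a4
    obtain ⟨z, hz, hzy, hzx, hact⟩ := hH.exists_join (by omega) (by omega) hx.1 hy.1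
      (h0.le.trans a3) (a4.trans (by rw [h0])) (h0.symm.le.trans a1) (a2.trans (by rw [h0]))
    obtain ⟨z', hz', hzz⟩ := hz.exists_isConfig (by omega)
    have hact' : action H (q - 1 + (q + 1)) z' = action H (q - 1) x + action H (q + 1) y := by
      rw [action_congr hzz]
      rw [h0] at hact
      linarith
    have hmax : IsMaximizer H L (p + p) (q - 1 + (q + 1)) z' :=
      ⟨hz', fun u hu => (hdouble u hu).trans (hcon.trans hact'.ge)⟩
    -- Around index `q + 1` the joined sequence and `y` differ only in the third vertex, so `unique`
    -- identifies `x 1` with `y 1`.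
    have c1 : z' q = y q := by rw [hzz q (by omega), hzy q (by omega) (by omega)]
    have c2 : z' (q + 1) = y (q + 1) := by
      rw [hzz _ (by omega), hzy _ (by omega) (by omega)]
    have c3 : z' (q + 2) = x 1 + p * L := by rw [hzz _ (by omega), hzx]
    have c4 : y (q + 2) = y 1 + p * L := by
      rw [← hy.1.closes 1]; congr 1; ring
    have m1 := hH.isLocalMax_vertex (by omega) (by omega) hmax q
    have m2 := hH.isLocalMax_vertex hp (by omega) hy q
    have n1 := hH.not_zero_step (by omega) (by omega) hmax (q + 1)
    have n2 := hH.not_full_step (by omega) (by omega) hmax (q + 1)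
    have n3 := hH.not_zero_step hp (by omega) hy (q + 1)
    have n4 := hH.not_full_step hp (by omega) hy (q + 1)
    rw [show q + 1 + 1 = q + 2 by rfl] at *
    rw [c1, c2, c3] at m1
    rw [c2, c3] at n1 n2
    rw [c4] at m2 n3 n4
    have := hH.unique _ _ _ _ (hH.not_zero_step hp (by omega) hy q)
      (hH.not_full_step hp (by omega) hy q) n1 n2 n3 n4 m1 m2
    linarith
  -- Translating `y` by a multiple of `L` keeps it a maximizer and puts it ahead of `x` at index 0.
  obtain ⟨k, hk⟩ := exists_nat_gt ((x 0 - y 0) / L)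
  rw [div_lt_iff₀ hL] at hk
  rw [← hH.action_add_mul k (x := y)] at hcon
  replace hy := hH.isMaximizer_add_mul hy k
  replace hk : x 0 ≤ (fun i => y i + k * L) 0 := by simp only; linarith
  generalize (fun i => y i + k * L) = y at *
  obtain ⟨i, hi1, hi2⟩ := hH.exists_crossing hp (by omega) hx.1 hy.1 hk
  have all : ∀ j, x j = y j → ∀ m, x (m + j) = y (m + j) := by
    intro j hj m
    induction m with
    | zero => simpa using hj
    | succ m ih =>
      have := step _ _ (hH.isMaximizer_shift hx (m + j)) (hH.isMaximizer_shift hy (m + j))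
        (by rwa [hH.action_shift hx.1, hH.action_shift hy.1]) (by simpa using ih)
      simpa [add_comm, add_left_comm, add_assoc] using this
  have noeq : ∀ j, x j ≠ y j := by
    -- After `(q - 1) * (q + 1)` further steps the two would have advanced by different multiples of
    -- `p * L`.
    intro j hj
    have h1 := (hx.1.shift j).closes_mul (q + 1)
    have h2 := (hy.1.shift j).closes_mul (q - 1)
    rw [mul_comm, all j hj, h2, zero_add, hj] at h1
    have h3 : ((q - 1 : ℕ) : ℝ) < ((q + 1 : ℕ) : ℝ) := by
      exact_mod_cast (by omega : q - 1 < q + 1)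
    have h4 : 0 < (p : ℝ) * L := mul_pos (by exact_mod_cast hp) hL
    have := mul_lt_mul_of_pos_right h3 h4
    linarith
  have s1 := lt_of_le_of_ne hi1 (noeq i)
  have s2 := lt_of_le_of_ne hi2 (noeq (i + 1)).symm
  have s3 := hy.1.le i
  have s4 := hx.1.le_add i
  have e1 : x (1 + i) = x (i + 1) := by rw [add_comm]
  have e2 : y (1 + i) = y (i + 1) := by rw [add_comm]
  have e3 : x (0 + i) = x i := by simp
  have e4 : y (0 + i) = y i := by simp
  obtain ⟨z, hz, -, -, hact⟩ := hH.exists_join (by omega) (by omega) (hx.1.shift i)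
    (hy.1.shift i) (by rw [e2, e3]; linarith) (by rw [e2, e3]; linarith)
    (by rw [e1, e4]; linarith) (by rw [e1, e4]; linarith)
  rw [e1, e2, e3, e4, hH.action_shift hx.1, hH.action_shift hy.1] at hact
  have := hH.super _ _ _ _ s1 s3 s2 s4
  linarith [hdouble z hz]

theorem continuous_action : Continuous (action H n) :=
  continuous_finsetSum _ fun i _ => by
    have h : Continuous fun x : ℕ → ℝ => (x i, x (i + 1)) := by fun_prop
    exact hH.cont.comp h

/-- Configurations of greatest action exist. -/
theorem exists_isMaximizer (hn : 0 < n) (hpn : p ≤ n) : ∃ x, IsMaximizer H L p n x := by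
  have hL := hH.pos
  have hn' : (0 : ℝ) < n := by exact_mod_cast hn
  set K : Set (ℕ → ℝ) := {x | x 0 ∈ Set.Icc 0 L ∧ IsConfig L p n x} with hK
  -- Compactness in the product topology, with the first vertex normalized to `[0, L]`; evenly
  -- spaced vertices show below that the set is nonempty.
  have hcompact : IsCompact K := by
    refine (isCompact_univ_pi fun i : ℕ => isCompact_Icc (a := (0 : ℝ)) (b := L + i * L)
      ).of_isClosed_subset ?_ ?_
    · have : K = {x | 0 ≤ x 0} ∩ {x | x 0 ≤ L} ∩ (⋂ i, {x | x i ≤ x (i + 1)}) ∩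
          (⋂ i, {x | x (i + 1) ≤ x i + L}) ∩ ⋂ i, {x | x (i + n) = x i + p * L} := by
        ext x
        simp only [hK, Set.mem_ofPred_eq, Set.mem_inter_iff, Set.mem_iInter, Set.mem_Icc]
        exact ⟨fun h => ⟨⟨⟨h.1, h.2.le⟩, h.2.le_add⟩, h.2.closes⟩,
          fun h => ⟨h.1.1.1, ⟨h.1.1.2, h.1.2, h.2⟩⟩⟩
      rw [this]
      refine (((IsClosed.inter ?_ ?_).inter ?_).inter ?_).inter ?_
      · exact isClosed_le (by fun_prop) (by fun_prop)
      · exact isClosed_le (by fun_prop) (by fun_prop)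
      · exact isClosed_iInter fun i => isClosed_le (by fun_prop) (by fun_prop)
      · exact isClosed_iInter fun i => isClosed_le (by fun_prop) (by fun_prop)
      · exact isClosed_iInter fun i => isClosed_eq (by fun_prop) (by fun_prop)
    · rintro x ⟨h0, hx⟩ i -
      induction i with
      | zero => simpa using h0
      | succ i ih =>
        refine ⟨ih.1.trans (hx.le i), (hx.le_add i).trans ?_⟩
        have := ih.2
        push_cast
        linarith
  have hne : K.Nonempty := by
    refine ⟨fun i => i * (p / n * L), by simp [hL.le], fun i => ?_, fun i => ?_, fun i => ?_⟩
    · have : 0 ≤ (p : ℝ) / n * L := by positivity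
      push_cast
      linarith
    · have h1 : (p : ℝ) / n ≤ 1 := (div_le_one hn').2 (by exact_mod_cast hpn)
      have := mul_le_mul_of_nonneg_right h1 hL.le
      push_cast
      linarith
    · push_cast
      field_simp
  obtain ⟨x, hx, hmax⟩ := hcompact.exists_isMaxOn hne hH.continuous_action.continuousOn (f := action H n)
  refine ⟨x, hx.2, fun y hy => ?_⟩
  obtain ⟨z, hz, hzy⟩ := hy.exists_isConfig hn
  rw [← action_congr hzy]
  obtain ⟨k, hk, -⟩ := existsUnique_add_zsmul_mem_Ico hL (z 0) 0
  rw [zero_add] at hk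
  have hkm : (fun i => z i + k * L) ∈ K :=
    ⟨by simpa using Set.Ico_subset_Icc_self hk, hz.add_const _⟩
  refine le_trans (le_of_eq ?_) (hmax hkm)
  refine Finset.sum_congr rfl fun i _ => ?_
  obtain ⟨m, rfl | rfl⟩ := k.eq_nat_or_neg
  · simp [hH.periodic_mul]
  · rw [← hH.periodic_mul m (z i + _)]
    simp

end IsTwistGenerating

end MagneticBilliard

/-! ### Plane geometry of the oval and the rolling theorem. -/

namespace MagneticBilliard

theorem cross_eq (z w : ℂ) : cross z w = z.re * w.im - z.im * w.re := by
  simp [cross]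
  ring

/-- The scalar product of two plane vectors. -/
def dot (z w : ℂ) : ℝ := z.re * w.re + z.im * w.im

theorem dot_sq_add_cross_sq (z w : ℂ) :
    dot z w ^ 2 + cross z w ^ 2 = Complex.normSq z * Complex.normSq w := by
  simp only [dot, cross_eq, Complex.normSq_apply]
  ring

theorem hasDerivAt_re {f : ℝ → ℂ} {f' : ℂ} {t : ℝ} (h : HasDerivAt f f' t) :
    HasDerivAt (fun τ => (f τ).re) f'.re t :=
  Complex.reCLM.hasFDerivAt.comp_hasDerivAt t h

theorem hasDerivAt_im {f : ℝ → ℂ} {f' : ℂ} {t : ℝ} (h : HasDerivAt f f' t) :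
    HasDerivAt (fun τ => (f τ).im) f'.im t :=
  Complex.imCLM.hasFDerivAt.comp_hasDerivAt t h

theorem hasDerivAt_cross {f g : ℝ → ℂ} {f' g' : ℂ} {t : ℝ} (hf : HasDerivAt f f' t)
    (hg : HasDerivAt g g' t) :
    HasDerivAt (fun τ => cross (f τ) (g τ)) (cross f' (g t) + cross (f t) g') t := by
  simp only [cross_eq]
  refine (((hasDerivAt_re hf).mul (hasDerivAt_im hg)).sub
    ((hasDerivAt_im hf).mul (hasDerivAt_re hg))).congr_deriv ?_
  ring

theorem hasDerivAt_dot {f g : ℝ → ℂ} {f' g' : ℂ} {t : ℝ} (hf : HasDerivAt f f' t)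
    (hg : HasDerivAt g g' t) :
    HasDerivAt (fun τ => dot (f τ) (g τ)) (dot f' (g t) + dot (f t) g') t := by
  simp only [dot]
  refine (((hasDerivAt_re hf).mul (hasDerivAt_re hg)).add
    ((hasDerivAt_im hf).mul (hasDerivAt_im hg))).congr_deriv ?_
  ring

theorem hasDerivAt_normSq {f : ℝ → ℂ} {f' : ℂ} {t : ℝ} (hf : HasDerivAt f f' t) :
    HasDerivAt (fun τ => Complex.normSq (f τ)) (2 * dot (f t) f') t := by
  have := hasDerivAt_dot hf hf
  refine (this.congr_deriv ?_).congr_of_eventuallyEq (Filter.Eventually.of_forall fun τ => ?_)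
  · simp only [dot]
    ring
  · simp [dot, Complex.normSq_apply]

namespace IsOval

variable {γ : ℝ → ℂ} {L R : ℝ}

theorem curvature_gt (hR : 0 < R) (hweak : 1 / R < curvatureMin γ) (s : ℝ) :
    1 / R < curvature γ s := by
  by_cases hb : BddBelow (Set.range (curvature γ))
  · exact hweak.trans_le (ciInf_le hb s)
  · have h0 : curvatureMin γ = 0 := Real.sInf_of_not_bddBelow hb
    rw [h0] at hweak
    -- An infimum unbounded below has the default value 0, which `1 / R < curvatureMin γ` excludes;
    -- no compactness is needed.
    exact absurd hweak (not_lt.2 (by positivity))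

variable (hγ : IsOval γ L)

include hγ

theorem exists_lift (s a : ℝ) : ∃ t ∈ Set.Ico a (a + L), γ t = γ s := by
  obtain ⟨k, hk, -⟩ := existsUnique_add_zsmul_mem_Ico hγ.length_pos s a
  refine ⟨_, hk, ?_⟩
  rw [hγ.periodic.zsmul k]

theorem ne_of_lt {s t : ℝ} (h1 : s < t) (h2 : t < s + L) : γ t ≠ γ s := by
  intro h
  have hL := hγ.length_pos
  obtain ⟨k, hk, -⟩ := existsUnique_add_zsmul_mem_Ico hL s 0
  obtain ⟨m, hm, -⟩ := existsUnique_add_zsmul_mem_Ico hL t 0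
  rw [zero_add] at hk hm
  have h3 := hγ.simple hm hk (by rw [hγ.periodic.zsmul, hγ.periodic.zsmul, h])
  rw [zsmul_eq_mul, zsmul_eq_mul] at h3
  have h4 : t - s = ((k - m : ℤ) : ℝ) * L := by
    push_cast
    linarith
  have h5 : (0 : ℝ) < ((k - m : ℤ) : ℝ) := by
    by_contra! hle
    nlinarith
  have h6 : ((k - m : ℤ) : ℝ) < 1 := by
    by_contra! hle
    nlinarith
  have h7 : 0 < k - m := by exact_mod_cast h5
  have h8 : k - m < 1 := by exact_mod_cast h6
  omega

theorem contDiff_deriv : ContDiff ℝ ∞ (deriv γ) :=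
  (contDiff_infty_iff_deriv.1 hγ.smooth).2

theorem contDiff_deriv_deriv : ContDiff ℝ ∞ (deriv (deriv γ)) :=
  (contDiff_infty_iff_deriv.1 hγ.contDiff_deriv).2

theorem hasDerivAt (s : ℝ) : HasDerivAt γ (deriv γ s) s :=
  ((contDiff_infty_iff_deriv.1 hγ.smooth).1 s).hasDerivAt

theorem hasDerivAt_deriv (s : ℝ) : HasDerivAt (deriv γ) (deriv (deriv γ) s) s :=
  ((contDiff_infty_iff_deriv.1 hγ.contDiff_deriv).1 s).hasDerivAt

theorem differentiable_curvature : Differentiable ℝ (curvature γ) := fun s =>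
  (hasDerivAt_cross (hγ.hasDerivAt_deriv s)
    ((contDiff_infty_iff_deriv.1 hγ.contDiff_deriv_deriv).1 s).hasDerivAt).differentiableAt

theorem continuous : Continuous γ := hγ.smooth.continuous

theorem periodic_deriv : Function.Periodic (deriv γ) L := fun s => by
  rw [← deriv_comp_add_const]
  congr 1
  exact funext hγ.periodic

theorem isCompact_range : IsCompact (Set.range γ) := by
  rw [← hγ.periodic.image_Icc hγ.length_pos 0]
  exact isCompact_Icc.image hγ.continuous

theorem normSq_deriv (s : ℝ) : Complex.normSq (deriv γ s) = 1 := by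
  rw [Complex.normSq_eq_norm_sq, hγ.unit_speed, one_pow]

theorem dot_deriv_deriv (s : ℝ) : dot (deriv γ s) (deriv (deriv γ) s) = 0 := by
  have h1 := hasDerivAt_normSq (hγ.hasDerivAt_deriv s)
  simp only [hγ.normSq_deriv] at h1
  have := h1.unique (hasDerivAt_const s 1)
  linarith

/-- The Frenet equation. -/
theorem dot_deriv_deriv_right (t s : ℝ) :
    dot (deriv γ t) (deriv (deriv γ) s) = - (curvature γ s * cross (deriv γ t) (deriv γ s)) := by
  have h1 := hγ.dot_deriv_deriv s
  have h2 := hγ.normSq_deriv s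
  simp only [curvature, dot, cross_eq, Complex.normSq_apply] at *
  linear_combination (-1 : ℝ) * ((deriv γ t).re * (deriv (deriv γ) s).re
    + (deriv γ t).im * (deriv (deriv γ) s).im) * h2 +
    ((deriv γ t).re * (deriv γ s).re + (deriv γ t).im * (deriv γ s).im) * h1

theorem cross_deriv_deriv_right (t s : ℝ) :
    cross (deriv γ t) (deriv (deriv γ) s) = curvature γ s * dot (deriv γ t) (deriv γ s) := by
  have h1 := hγ.dot_deriv_deriv s
  have h2 := hγ.normSq_deriv s
  simp only [curvature, dot, cross_eq, Complex.normSq_apply] at *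
  linear_combination (-1 : ℝ) * ((deriv γ t).re * (deriv (deriv γ) s).im
    - (deriv γ t).im * (deriv (deriv γ) s).re) * h2 +
    ((deriv γ t).re * (deriv γ s).im - (deriv γ t).im * (deriv γ s).re) * h1

/-- Were the parallel tangents equally directed, each point would lie strictly to the left of the
tangent at the other. -/
theorem dot_neg_of_cross_eq_zero {s t : ℝ} (hne : γ s ≠ γ t)
    (h : cross (deriv γ t) (deriv γ s) = 0) : dot (deriv γ t) (deriv γ s) < 0 := by
  by_contra! hdot
  have h1 := dot_sq_add_cross_sq (deriv γ t) (deriv γ s)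
  rw [h, hγ.normSq_deriv, hγ.normSq_deriv] at h1
  have h2 : dot (deriv γ t) (deriv γ s) = 1 := by nlinarith
  have h3 := hγ.strictly_convex t s hne
  have h4 := hγ.strictly_convex s t hne.symm
  have h5 := hγ.normSq_deriv t
  have h6 : deriv γ s = deriv γ t := by
    have h7 := hγ.normSq_deriv s
    simp only [dot, cross_eq, Complex.normSq_apply] at *
    apply Complex.ext
    · linear_combination (deriv γ t).re * h2 - (deriv γ t).im * h - (deriv γ s).re * h5
    · linear_combination (deriv γ t).im * h2 + (deriv γ t).re * h - (deriv γ s).im * h5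
  rw [h6] at h4
  simp only [cross_eq, Complex.sub_re, Complex.sub_im] at h3 h4
  linarith

/-- The height of the oval above its tangent at `γ t` is compared with that of a circle of radius
`R` at the point with the same tangent direction. The derivative of the difference `E` is `(R *
curvature - 1)` times the sine of the turning angle. Interior critical points have antiparallel
tangents and are strict local maxima, so `E` attains its minimum 0 over a period only at the ends.
-/
theorem support_lt (hk : ∀ s, 1 / R < curvature γ s) (hR : 0 < R) {s t : ℝ}
    (hne : γ s ≠ γ t) :
    cross (deriv γ t) (γ s - γ t) < R * (1 - dot (deriv γ t) (deriv γ s)) := by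
  have hL := hγ.length_pos
  set E : ℝ → ℝ := fun σ => R * (1 - dot (deriv γ t) (deriv γ σ)) - cross (deriv γ t) (γ σ - γ t)
    with hE
  have hcross : ∀ σ, HasDerivAt (fun σ => cross (deriv γ t) (γ σ - γ t))
      (cross (deriv γ t) (deriv γ σ)) σ := fun σ => by
    refine (hasDerivAt_cross (hasDerivAt_const σ (deriv γ t))
      ((hγ.hasDerivAt σ).sub_const (γ t))).congr_deriv ?_
    simp [cross_eq]
  have hd : ∀ σ, HasDerivAt E ((R * curvature γ σ - 1) * cross (deriv γ t) (deriv γ σ)) σ := by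
    intro σ
    refine ((((hasDerivAt_dot (hasDerivAt_const σ (deriv γ t)) (hγ.hasDerivAt_deriv σ)).const_sub
      1).const_mul R).sub (hcross σ)).congr_deriv ?_
    rw [hγ.dot_deriv_deriv_right]
    simp [dot]
    ring
  have hE' : deriv E = fun σ => (R * curvature γ σ - 1) * cross (deriv γ t) (deriv γ σ) :=
    funext fun σ => (hd σ).deriv
  have hcont : Continuous E := continuous_iff_continuousAt.2 fun σ => (hd σ).continuousAt
  have hper : Function.Periodic E L := fun σ => by
    simp only [hE, hγ.periodic σ, hγ.periodic_deriv σ]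
  have hEt : E t = 0 := by
    have := hγ.normSq_deriv t
    rw [Complex.normSq_apply] at this
    simp [hE, dot, cross_eq, this]
  have hnot : ∀ σ ∈ Set.Ioo t (t + L), ¬ IsMinOn E (Set.Icc t (t + L)) σ := by
    intro σ hσ hmin
    have hloc : IsLocalMin E σ := hmin.isLocalMin (Icc_mem_nhds hσ.1 hσ.2)
    have h0 := hloc.deriv_eq_zero
    have hkσ : 0 < R * curvature γ σ - 1 := by
      have := hk σ
      rw [div_lt_iff₀ hR] at this
      linarith
    have hc : cross (deriv γ t) (deriv γ σ) = 0 := by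
      rw [(hd σ).deriv] at h0
      exact (mul_eq_zero.1 h0).resolve_left hkσ.ne'
    have hdot := hγ.dot_neg_of_cross_eq_zero (hγ.ne_of_lt hσ.1 hσ.2) hc
    have hdd : deriv (deriv E) σ < 0 := by
      have h1 := (((hγ.differentiable_curvature σ).hasDerivAt.const_mul R).sub_const 1).mul
        (hasDerivAt_cross (hasDerivAt_const σ (deriv γ t)) (hγ.hasDerivAt_deriv σ))
      rw [hE']
      refine (h1.deriv.trans_lt ?_)
      rw [hc, hγ.cross_deriv_deriv_right]
      have h2 : cross 0 (deriv γ σ) = 0 := by simp [cross_eq]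
      have hkσ' : 0 < curvature γ σ := lt_trans (by positivity) (hk σ)
      rw [h2, mul_zero, zero_add, zero_add]
      exact mul_neg_of_pos_of_neg hkσ (mul_neg_of_pos_of_neg hkσ' hdot)
    have hmax := isLocalMax_of_deriv_deriv_neg hdd h0 hcont.continuousAt
    have hconst : E =ᶠ[nhds σ] fun _ => E σ := by
      filter_upwards [hloc, hmax] with τ h1 h2
      exact le_antisymm h2 h1
    have := hconst.deriv.deriv_eq
    simp at this
    linarith
  obtain ⟨σ, hσ, hσs⟩ := hγ.exists_lift s t
  have hσt : t < σ := lt_of_le_of_ne hσ.1 fun h => hne (by rw [← hσs, h])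
  have hpos : 0 < E σ := by
    obtain ⟨m, hm, hmin⟩ := isCompact_Icc.exists_isMinOn
      (Set.nonempty_Icc.2 (by linarith : t ≤ t + L)) hcont.continuousOn (f := E)
    have hm0 : E m = 0 := by
      rcases eq_or_ne m t with rfl | h1
      · exact hEt
      rcases eq_or_ne m (t + L) with rfl | h2
      · rw [hper, hEt]
      · exact absurd hmin (hnot m ⟨lt_of_le_of_ne hm.1 h1.symm, lt_of_le_of_ne hm.2 h2⟩)
    have hge : ∀ τ ∈ Set.Icc t (t + L), 0 ≤ E τ := fun τ hτ => hm0 ▸ hmin hτ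
    refine lt_of_le_of_ne (hge σ ⟨hσ.1, hσ.2.le⟩) fun h => hnot σ ⟨hσt, hσ.2⟩ fun τ hτ => ?_
    rw [Set.mem_ofPred_eq, ← h]
    exact hge τ hτ
  obtain ⟨k, hk1, -⟩ := existsUnique_add_zsmul_mem_Ico hL s t
  have hEs : E s = E σ := by
    have h1 : s + k • L = σ := by
      by_contra hcon
      have hγeq : γ (s + k • L) = γ σ := by rw [hγ.periodic.zsmul, hσs]
      rcases lt_or_gt_of_ne hcon with h | h
      · exact hγ.ne_of_lt h (by linarith [hk1.1, hσ.2]) hγeq.symm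
      · exact hγ.ne_of_lt h (by linarith [hk1.2, hσ.1]) hγeq
    rw [← h1, hper.zsmul]
  rw [← hEs] at hpos
  simp only [hE] at hpos
  linarith

/-- **Blaschke's rolling theorem**: the oval lies strictly inside the circle of radius `R` that is
tangent to it at `γ s`. -/
theorem normSq_lt (hk : ∀ s, 1 / R < curvature γ s) (hR : 0 < R) {s t : ℝ} (hne : γ t ≠ γ s) :
    Complex.normSq (γ t - γ s) < 2 * R * cross (deriv γ s) (γ t - γ s) := by
  set C : ℂ := γ s + R * (Complex.I * deriv γ s) with hC
  have hm : ∀ τ, Complex.normSq (γ τ - C) = Complex.normSq (γ τ - γ s)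
      - 2 * R * cross (deriv γ s) (γ τ - γ s) + R ^ 2 := by
    intro τ
    have := hγ.normSq_deriv s
    simp only [hC, cross_eq, Complex.normSq_apply, Complex.sub_re, Complex.sub_im,
      Complex.add_re, Complex.add_im, Complex.mul_re, Complex.mul_im, Complex.I_re, Complex.I_im,
      Complex.ofReal_re, Complex.ofReal_im] at this ⊢
    linear_combination R ^ 2 * this
  -- At a point farthest from the centre `C` the radius is normal to the oval, so its length is the
  -- absolute value of a cross product, which `support_lt` and convexity bound by `R`.
  have hcrit : ∀ τ, (∀ σ, Complex.normSq (γ σ - C) ≤ Complex.normSq (γ τ - C)) → γ τ ≠ γ s →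
      Complex.normSq (γ τ - C) < R ^ 2 := by
    intro τ hmax hτ
    have hd := hasDerivAt_normSq ((hγ.hasDerivAt τ).sub_const C)
    have hloc : IsLocalMax (fun σ => Complex.normSq (γ σ - C)) τ :=
      Filter.Eventually.of_forall hmax
    have h0 := hloc.hasDerivAt_eq_zero hd
    have h1 := dot_sq_add_cross_sq (γ τ - C) (deriv γ τ)
    rw [hγ.normSq_deriv, mul_one, show dot (γ τ - C) (deriv γ τ) = 0 by linarith] at h1
    rw [← h1]
    have h2 := hγ.support_lt hk hR hτ.symm
    have h3 := hγ.strictly_convex τ s hτ.symm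
    have h4 : cross (γ τ - C) (deriv γ τ) = cross (deriv γ τ) (γ s - γ τ)
        + R * dot (deriv γ τ) (deriv γ s) := by
      simp only [hC, cross_eq, dot, Complex.sub_re, Complex.sub_im,
        Complex.add_re, Complex.add_im, Complex.mul_re, Complex.mul_im, Complex.I_re, Complex.I_im,
        Complex.ofReal_re, Complex.ofReal_im]
      ring
    have h5 := dot_sq_add_cross_sq (deriv γ τ) (deriv γ s)
    rw [hγ.normSq_deriv, hγ.normSq_deriv] at h5
    have h6 : -1 ≤ dot (deriv γ τ) (deriv γ s) := by
      nlinarith [sq_nonneg (cross (deriv γ τ) (deriv γ s))]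
    have h7 : R * (-1) ≤ R * dot (deriv γ τ) (deriv γ s) := mul_le_mul_of_nonneg_left h6 hR.le
    rw [h4]
    rw [zero_pow two_ne_zero, zero_add]
    exact sq_lt_sq' (by linarith) (by linarith)
  obtain ⟨_, ⟨τ, rfl⟩, hmax⟩ := hγ.isCompact_range.exists_isMaxOn ⟨_, s, rfl⟩
    (f := fun z => Complex.normSq (z - C))
    (Complex.continuous_normSq.comp (continuous_id.sub continuous_const)).continuousOn
  replace hmax : ∀ σ, Complex.normSq (γ σ - C) ≤ Complex.normSq (γ τ - C) :=
    fun σ => hmax ⟨σ, rfl⟩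
  have hlt : Complex.normSq (γ t - C) < R ^ 2 := by
    by_contra! hge
    by_cases hτ : γ τ = γ s
    · have h1 : Complex.normSq (γ τ - C) = R ^ 2 := by rw [hm, hτ]; simp [cross_eq]
      exact absurd (hcrit t (fun σ => (hmax σ).trans (h1.trans_le hge)) hne) (not_lt.2 hge)
    · exact absurd ((hge.trans (hmax t)).trans_lt (hcrit τ hmax hτ)) (lt_irrefl _)
  rw [hm] at hlt
  linarith

theorem dist_lt (hk : ∀ s, 1 / R < curvature γ s) (hR : 0 < R) (s t : ℝ) :
    ‖γ t - γ s‖ < 2 * R := by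
  by_cases hne : γ t = γ s
  · rw [hne, sub_self, norm_zero]
    positivity
  have h1 := hγ.normSq_lt hk hR hne
  have h2 := dot_sq_add_cross_sq (deriv γ s) (γ t - γ s)
  have hpos : 0 < ‖γ t - γ s‖ := norm_pos_iff.2 (sub_ne_zero.2 hne)
  rw [hγ.normSq_deriv, one_mul] at h2
  rw [Complex.normSq_eq_norm_sq] at h1 h2
  have h3 : cross (deriv γ s) (γ t - γ s) ≤ ‖γ t - γ s‖ :=
    abs_le_of_sq_le_sq' (by nlinarith [sq_nonneg (dot (deriv γ s) (γ t - γ s))]) hpos.le |>.2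
  by_contra! hge
  nlinarith

end IsOval

end MagneticBilliard

/-! ### The generating function of the magnetic billiard and its twist property. -/

noncomputable section

namespace MagneticBilliard

/-- The length of the short arc of radius `R` with chord `r`, diminished by `1 / R` times the area
of its circular segment. -/
def segmentValue (R r : ℝ) : ℝ :=
  R * (Real.arcsin (r / (2 * R)) + r / (2 * R) * √(1 - (r / (2 * R)) ^ 2))

/-- The contribution of the side from `γ s` to `γ t` to the functional
`perimeter - (1 / R) * area`. -/
def generating (γ : ℝ → ℂ) (R s t : ℝ) : ℝ :=
  segmentValue R ‖γ t - γ s‖ - cross (γ s) (γ t) / (2 * R)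

theorem hasDerivAt_segmentValue {R r : ℝ} (hR : 0 < R) (h0 : 0 < r) (h1 : r < 2 * R) :
    HasDerivAt (segmentValue R) (√(1 - (r / (2 * R)) ^ 2)) r := by
  have hu0 : 0 < r / (2 * R) := by positivity
  have hu1 : r / (2 * R) < 1 := (div_lt_one (by positivity)).2 h1
  have hsq : 0 < 1 - (r / (2 * R)) ^ 2 := by nlinarith
  have hid : HasDerivAt (fun r : ℝ => r / (2 * R)) (1 / (2 * R)) r :=
    (hasDerivAt_id r).div_const _
  have harc := (Real.hasDerivAt_arcsin (by linarith) hu1.ne).comp r hid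
  have hsqrt := ((hid.pow 2).const_sub 1).sqrt hsq.ne'
  refine ((harc.add (hid.mul hsqrt)).const_mul R).congr_deriv ?_
  have hs := Real.sq_sqrt hsq.le
  have hspos := Real.sqrt_pos.2 hsq
  simp only [Pi.pow_apply]
  generalize √(1 - (r / (2 * R)) ^ 2) = w at *
  push_cast
  have hs' : w ^ 2 * (4 * R ^ 2) = 4 * R ^ 2 - r ^ 2 := by
    rw [hs]
    field_simp
    ring
  field_simp
  linear_combination (-1 : ℝ) * hs'

/-- With `q = chordCoeff R (‖w‖ ^ 2)`, the unit tangent vector at the start of a side with chord `w`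
is `q * w - i * w / (2 * R)`. -/
def chordCoeff (R ρ : ℝ) : ℝ := √(1 / ρ - 1 / (4 * R ^ 2))

theorem chordCoeff_pos {R ρ : ℝ} (h0 : 0 < ρ) (h1 : ρ < 4 * R ^ 2) :
    0 < chordCoeff R ρ := by
  refine Real.sqrt_pos.2 (sub_pos.2 ?_)
  exact one_div_lt_one_div_of_lt h0 h1

theorem chordCoeff_sq {R ρ : ℝ} (h0 : 0 < ρ) (h1 : ρ < 4 * R ^ 2) :
    chordCoeff R ρ ^ 2 = 1 / ρ - 1 / (4 * R ^ 2) :=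
  Real.sq_sqrt (sub_pos.2 (one_div_lt_one_div_of_lt h0 h1)).le

theorem hasDerivAt_chordCoeff {R ρ : ℝ} (h0 : 0 < ρ) (h1 : ρ < 4 * R ^ 2) :
    HasDerivAt (chordCoeff R) (-1 / (2 * ρ ^ 2 * chordCoeff R ρ)) ρ := by
  have hpos := sub_pos.2 (one_div_lt_one_div_of_lt h0 h1)
  have hq := chordCoeff_pos h0 h1
  have hinv : HasDerivAt (fun ρ : ℝ => 1 / ρ - 1 / (4 * R ^ 2)) (-1 / ρ ^ 2) ρ := by
    simpa [neg_div] using ((hasDerivAt_inv h0.ne').sub_const (1 / (4 * R ^ 2)))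
  refine (hinv.sqrt hpos.ne').congr_deriv ?_
  change -1 / ρ ^ 2 / (2 * chordCoeff R ρ) = _
  field_simp

/-- The derivative of `generating γ R s t` with respect to `s`. -/
def generatingDeriv (γ : ℝ → ℂ) (R s t : ℝ) : ℝ :=
  -(chordCoeff R (Complex.normSq (γ t - γ s)) * dot (deriv γ s) (γ t - γ s))
    - cross (deriv γ s) (γ t) / (2 * R)

/-- With `X` and `Y` the components of the chord along the tangent and the inner normal, the
quantity is the sine of the angle between oval and side; `hY` is the rolling inequality. -/
theorem mul_cross_sub_dot_pos {R q X Y ρ : ℝ} (hR : 0 < R) (h0 : 0 < ρ) (hq : 0 < q)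
    (hq2 : q ^ 2 = 1 / ρ - 1 / (4 * R ^ 2)) (hXY : X ^ 2 + Y ^ 2 = ρ) (hY : ρ < 2 * R * Y) :
    0 < q * Y - X / (2 * R) := by
  have hY0 : 0 < Y := by
    by_contra! h
    nlinarith
  have h1 : (X / (2 * R)) ^ 2 < (q * Y) ^ 2 := by
    have e : (q * Y) ^ 2 - (X / (2 * R)) ^ 2 = (Y ^ 2 * (4 * R ^ 2) - ρ ^ 2) / (ρ * (4 * R ^ 2)) := by
      rw [mul_pow, hq2, ← hXY]
      rw [← hXY] at h0
      field_simp
      ring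
    have : 0 < (Y ^ 2 * (4 * R ^ 2) - ρ ^ 2) / (ρ * (4 * R ^ 2)) := by
      apply div_pos
      · nlinarith
      · positivity
    linarith
  have := (abs_lt_of_sq_lt_sq' h1 (by positivity)).2
  linarith

namespace IsOval

variable {γ : ℝ → ℂ} {L R : ℝ} (hγ : IsOval γ L)

include hγ

theorem normSq_lt_four_mul (hk : ∀ s, 1 / R < curvature γ s) (hR : 0 < R) (s t : ℝ) :
    Complex.normSq (γ t - γ s) < 4 * R ^ 2 := by
  have h1 := hγ.dist_lt hk hR s t
  rw [Complex.normSq_eq_norm_sq]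
  nlinarith [norm_nonneg (γ t - γ s)]

theorem hasDerivAt_generating (hk : ∀ s, 1 / R < curvature γ s) (hR : 0 < R) {s t : ℝ}
    (hne : γ t ≠ γ s) :
    HasDerivAt (fun σ => generating γ R σ t) (generatingDeriv γ R s t) s := by
  have hr : 0 < ‖γ t - γ s‖ := norm_pos_iff.2 (sub_ne_zero.2 hne)
  have hr2 := hγ.dist_lt hk hR s t
  have hsq : 0 < Complex.normSq (γ t - γ s) := Complex.normSq_pos.2 (sub_ne_zero.2 hne)
  have hw := (hγ.hasDerivAt s).const_sub (γ t)
  have hnorm : HasDerivAt (fun σ => ‖γ t - γ σ‖)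
      (-dot (deriv γ s) (γ t - γ s) / ‖γ t - γ s‖) s := by
    have h := (hasDerivAt_normSq hw).sqrt hsq.ne'
    simp only [Complex.normSq_eq_norm_sq, Real.sqrt_sq (norm_nonneg _)] at h
    refine h.congr_deriv ?_
    rw [mul_div_mul_left _ _ two_ne_zero]
    simp only [dot, Complex.neg_re, Complex.neg_im]
    ring
  have hG := (hasDerivAt_segmentValue hR hr hr2).comp s hnorm
  have hc := (hasDerivAt_cross (hγ.hasDerivAt s) (hasDerivAt_const s (γ t))).div_const (2 * R)
  refine (hG.sub hc).congr_deriv ?_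
  have hq : √(1 - (‖γ t - γ s‖ / (2 * R)) ^ 2) =
      chordCoeff R (Complex.normSq (γ t - γ s)) * ‖γ t - γ s‖ := by
    rw [chordCoeff, Complex.normSq_eq_norm_sq]
    nth_rewrite 3 [← Real.sqrt_sq hr.le]
    rw [← Real.sqrt_mul' _ (sq_nonneg _)]
    congr 1
    field_simp
    ring
  have h0 : cross (γ s) 0 = 0 := by simp [cross_eq]
  rw [hq, h0, add_zero, generatingDeriv]
  congr 1
  field_simp

/-- This is the twist condition. Up to a term depending on `s` alone, `generatingDeriv` is minus the
cosine of the angle between oval and side at `γ s`. Multiplied by `q * ρ`, its derivative in `t` is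
the product of the sines of the angles at the two ends. -/
theorem generatingDeriv_strictMonoOn (hk : ∀ s, 1 / R < curvature γ s) (hR : 0 < R) (s : ℝ) :
    StrictMonoOn (generatingDeriv γ R s) (Set.Ioo s (s + L)) := by
  have hd : ∀ t ∈ Set.Ioo s (s + L), ∃ d, 0 < d ∧ HasDerivAt (generatingDeriv γ R s) d t := by
    intro t ht
    have hne := hγ.ne_of_lt ht.1 ht.2
    have h0 : 0 < Complex.normSq (γ t - γ s) := Complex.normSq_pos.2 (sub_ne_zero.2 hne)
    have h1 := hγ.normSq_lt_four_mul hk hR s t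
    have hq := chordCoeff_pos h0 h1
    have hq2 := chordCoeff_sq h0 h1
    have hw := (hγ.hasDerivAt t).sub_const (γ s)
    have hρ := hasDerivAt_normSq hw
    have hQ : HasDerivAt (fun t => chordCoeff R (Complex.normSq (γ t - γ s))) _ t :=
      HasDerivAt.comp (h₂ := chordCoeff R) t (hasDerivAt_chordCoeff h0 h1) hρ
    have hD := hasDerivAt_dot (hasDerivAt_const t (deriv γ s)) hw
    have hC := hasDerivAt_cross (hasDerivAt_const t (deriv γ s)) (hγ.hasDerivAt t)
    have hh := (hQ.mul hD).neg.sub (hC.div_const (2 * R))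
    refine ⟨_, ?_, hh⟩
    have hK1 := hγ.normSq_lt hk hR hne
    have hK2 := hγ.normSq_lt hk hR hne.symm
    have hs := dot_sq_add_cross_sq (deriv γ s) (γ t - γ s)
    have ht := dot_sq_add_cross_sq (deriv γ t) (γ t - γ s)
    rw [hγ.normSq_deriv, one_mul] at hs ht
    have e1 : cross (deriv γ t) (γ s - γ t) = -cross (deriv γ t) (γ t - γ s) := by
      simp only [cross_eq, Complex.sub_re, Complex.sub_im]; ring
    rw [e1, ← Complex.normSq_neg, neg_sub] at hK2
    rw [← neg_sq (cross _ _)] at ht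
    have p1 := mul_cross_sub_dot_pos hR h0 hq hq2 hs hK1
    have p2 := mul_cross_sub_dot_pos hR h0 hq hq2 ht hK2
    have hprod := mul_pos p1 p2
    have hmul : 0 < chordCoeff R (Complex.normSq (γ t - γ s)) *
      Complex.normSq (γ t - γ s) := mul_pos hq h0
    refine (mul_pos_iff_of_pos_left hmul).1 (hprod.trans_eq ?_)
    have hρ' : Complex.normSq (γ t - γ s) = (γ t - γ s).re * (γ t - γ s).re
        + (γ t - γ s).im * (γ t - γ s).im := Complex.normSq_apply _
    generalize Complex.normSq (γ t - γ s) = ρ at *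
    generalize chordCoeff R ρ = q at *
    generalize γ t - γ s = w at *
    have e2 : ∀ A B D E : ℝ, q * ρ * (-(-1 / (2 * ρ ^ 2 * q) * (2 * A) * B + q * D) - E) =
        A * B * (1 / ρ) - q ^ 2 * ρ * D - q * ρ * E := fun A B D E => by
      field_simp
      ring
    have z1 : dot 0 w = 0 := by simp [dot]
    have z2 : cross 0 (γ t) = 0 := by simp [cross_eq]
    have e3 : 1 / ρ = q ^ 2 + 1 / (4 * R ^ 2) := by linarith
    rw [z1, z2, zero_add, zero_add, e2, e3]
    simp only [cross_eq, dot]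
    linear_combination (q ^ 2 * ((deriv γ s).re * (deriv γ t).re + (deriv γ s).im * (deriv γ t).im)
      + q / (2 * R) * ((deriv γ s).re * (deriv γ t).im - (deriv γ s).im * (deriv γ t).re)) * hρ'
  have hdiff : ∀ t ∈ Set.Ioo s (s + L), 0 < deriv (generatingDeriv γ R s) t := fun t ht => by
    obtain ⟨d, hd, h⟩ := hd t ht
    rwa [h.deriv]
  refine strictMonoOn_of_deriv_pos (convex_Ioo _ _) (fun t ht => ?_) fun t ht => ?_
  · obtain ⟨d, -, h⟩ := hd t ht
    exact h.continuousAt.continuousWithinAt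
  · rw [interior_Ioo] at ht
    exact hdiff t ht

theorem isTwistGenerating (hk : ∀ s, 1 / R < curvature γ s) (hR : 0 < R) :
    IsTwistGenerating (generating γ R) L where
  pos := hγ.length_pos
  cont := by
    have h := hγ.continuous
    simp only [generating, segmentValue, cross_eq]
    fun_prop
  periodic s t := by simp only [generating, hγ.periodic s, hγ.periodic t]
  diag s := by simp [generating, segmentValue, cross_eq, mul_comm]
  diag_add s := by simp [generating, segmentValue, cross_eq, mul_comm, hγ.periodic s]
  super s s' t t' h1 h2 h3 h4 := by
    have hcont : ∀ τ, Continuous fun σ => generating γ R σ τ := fun τ => by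
      have h := hγ.continuous
      simp only [generating, segmentValue, cross_eq]
      fun_prop
    -- Differentiability can fail at degenerate steps, which occur only at the ends of the interval,
    -- where continuity suffices.
    have hmono : StrictMonoOn (fun σ => generating γ R σ t' - generating γ R σ t)
        (Set.Icc s s') := by
      refine strictMonoOn_of_deriv_pos (convex_Icc _ _)
        ((hcont t').sub (hcont t)).continuousOn fun σ hσ => ?_
      rw [interior_Icc] at hσ
      have a1 : σ < t := hσ.2.trans_le h2
      have a2 : t' < σ + L := h4.trans_lt (by linarith [hσ.1])
      refine lt_of_lt_of_eq ?_ ((hγ.hasDerivAt_generating hk hR (hγ.ne_of_lt (a1.trans h3) a2)).sub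
        (hγ.hasDerivAt_generating hk hR (hγ.ne_of_lt a1 (h3.trans a2)))).deriv.symm
      rw [sub_pos]
      exact hγ.generatingDeriv_strictMonoOn hk hR σ ⟨a1, h3.trans a2⟩ ⟨a1.trans h3, a2⟩ h3
    have := hmono ⟨le_rfl, h1.le⟩ ⟨h1.le, le_rfl⟩ h1
    simp only at this
    linarith
  unique a b c c' h1 h2 h3 h4 h5 h6 hmax hmax' := by
    have hne := hγ.ne_of_lt h1 h2
    -- The value of this derivative is irrelevant: it is the same in both critical point equations
    -- and cancels.
    have hA : DifferentiableAt ℝ (fun τ => generating γ R a τ) b := by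
      have e : (fun τ => generating γ R a τ) = fun τ => generating γ R τ a
          + (cross (γ τ) (γ a) - cross (γ a) (γ τ)) / (2 * R) := by
        funext τ
        simp only [generating, norm_sub_rev (γ τ)]
        ring
      rw [e]
      exact ((hγ.hasDerivAt_generating hk hR hne.symm).add
        (((hasDerivAt_cross (hγ.hasDerivAt b) (hasDerivAt_const b (γ a))).sub
          (hasDerivAt_cross (hasDerivAt_const b (γ a)) (hγ.hasDerivAt b))).div_const
            (2 * R))).differentiableAt
    have d1 := hmax.hasDerivAt_eq_zero
      (hA.hasDerivAt.add (hγ.hasDerivAt_generating hk hR (hγ.ne_of_lt h3 h4)))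
    have d2 := hmax'.hasDerivAt_eq_zero
      (hA.hasDerivAt.add (hγ.hasDerivAt_generating hk hR (hγ.ne_of_lt h5 h6)))
    exact (hγ.generatingDeriv_strictMonoOn hk hR b).injOn ⟨h3, h4⟩ ⟨h5, h6⟩ (by linarith)

end IsOval

end MagneticBilliard

end

/-! ### Circular arcs and the reduction of the functional to the generating function. -/

noncomputable section

namespace MagneticBilliard

/-- In a finite-dimensional space the convex hull of a compact set is compact. -/
theorem isCompact_convexHull {E : Type*} [NormedAddCommGroup E] [NormedSpace ℝ E]
    [FiniteDimensional ℝ E] {s : Set E} (hs : IsCompact s) : IsCompact (convexHull ℝ s) := by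
  rcases s.eq_empty_or_nonempty with rfl | ⟨x₀, hx₀⟩
  · simp
  set d := Module.finrank ℝ E + 1
  set Φ : (Fin d → ℝ) × (Fin d → E) → E := fun z => ∑ i, z.1 i • z.2 i with hΦ
  have hcont : Continuous Φ := by fun_prop
  -- By Carathéodory's theorem `d` points suffice; shorter combinations are padded with weight 0 at
  -- `x₀`.
  have himage : convexHull ℝ s = Φ '' (stdSimplex ℝ (Fin d) ×ˢ Set.univ.pi fun _ => s) := by
    apply Set.Subset.antisymm
    · intro x hx
      obtain ⟨ι, _, z, w, hz, hind, hw, hsum, rfl⟩ := eq_pos_convex_span_of_mem_convexHull hx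
      obtain ⟨e⟩ : Nonempty (ι ↪ Fin d) := Function.Embedding.nonempty_of_card_le (by
        rw [Fintype.card_fin]
        refine hind.card_le_finrank_succ.trans ?_
        exact Nat.succ_le_succ (Submodule.finrank_le _))
      have hout : ∀ i ∉ Set.range e, Function.extend e w 0 i = 0 := fun i hi =>
        Function.extend_apply' _ _ _ hi
      refine ⟨(Function.extend e w 0, Function.extend e z fun _ => x₀), ⟨⟨fun i => ?_, ?_⟩, ?_⟩, ?_⟩
      · by_cases hi : i ∈ Set.range e
        · obtain ⟨j, rfl⟩ := hi
          simp only [e.injective.extend_apply]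
          exact (hw j).le
        · exact (hout i hi).ge
      · rw [← hsum]
        exact (Fintype.sum_of_injective e e.injective _ _ hout
          fun j => (e.injective.extend_apply _ _ _).symm).symm
      · intro i _
        by_cases hi : i ∈ Set.range e
        · obtain ⟨j, rfl⟩ := hi
          simp only [e.injective.extend_apply]
          exact hz ⟨j, rfl⟩
        · simp only [Function.extend_apply' _ _ _ hi]
          exact hx₀
      · refine (Fintype.sum_of_injective e e.injective _ _ (fun i hi => ?_) fun j => ?_).symm
        · simp only [hout i hi, zero_smul]
        · simp only [e.injective.extend_apply]
    · rintro _ ⟨⟨w, z⟩, ⟨hw, hz⟩, rfl⟩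
      exact (convex_convexHull ℝ s).sum_mem (fun i _ => hw.1 i) hw.2
        fun i _ => subset_convexHull ℝ s (hz i trivial)
  rw [himage]
  exact ((isCompact_stdSimplex ℝ (Fin d)).prod (isCompact_univ_pi fun _ => hs)).image hcont

theorem circlePoint_re (c : ℂ) (R θ : ℝ) : (circlePoint c R θ).re = c.re + R * Real.cos θ := by
  simp [circlePoint, Complex.exp_ofReal_mul_I_re]

theorem circlePoint_im (c : ℂ) (R θ : ℝ) : (circlePoint c R θ).im = c.im + R * Real.sin θ := by
  simp [circlePoint, Complex.exp_ofReal_mul_I_im]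

theorem hasDerivAt_circlePoint (c : ℂ) (R θ : ℝ) :
    HasDerivAt (circlePoint c R) (R * (Complex.exp (θ * Complex.I) * Complex.I)) θ := by
  have h : HasDerivAt (fun θ : ℝ => (θ : ℂ) * Complex.I) Complex.I θ := by
    simpa using (Complex.ofRealCLM.hasDerivAt (x := θ)).mul_const Complex.I
  exact (h.cexp.const_mul (R : ℂ)).const_add c

theorem cross_circlePoint_deriv (c : ℂ) (R θ : ℝ) :
    cross (circlePoint c R θ) (deriv (circlePoint c R) θ) =
      R ^ 2 + R * (c.re * Real.cos θ + c.im * Real.sin θ) := by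
  rw [(hasDerivAt_circlePoint c R θ).deriv, cross_eq, circlePoint_re, circlePoint_im]
  simp only [Complex.mul_re, Complex.mul_im, Complex.exp_ofReal_mul_I_re,
    Complex.exp_ofReal_mul_I_im, Complex.ofReal_re, Complex.ofReal_im, Complex.I_re, Complex.I_im]
  linear_combination R ^ 2 * Real.sin_sq_add_cos_sq θ

theorem normSq_circlePoint_sub (c : ℂ) (R α β : ℝ) :
    Complex.normSq (circlePoint c R β - circlePoint c R α) =
      (2 * R * Real.sin ((β - α) / 2)) ^ 2 := by
  have h1 : Real.sin ((β - α) / 2) ^ 2 = (1 - Real.cos (β - α)) / 2 := by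
    have := Real.cos_sq ((β - α) / 2)
    rw [mul_div_cancel₀ _ (two_ne_zero' ℝ)] at this
    linarith [Real.sin_sq_add_cos_sq ((β - α) / 2)]
  rw [mul_pow, h1, Real.cos_sub, Complex.normSq_apply]
  simp only [Complex.sub_re, Complex.sub_im, circlePoint_re, circlePoint_im]
  linear_combination R ^ 2 * Real.sin_sq_add_cos_sq α + R ^ 2 * Real.sin_sq_add_cos_sq β

theorem normSq_circlePoint_sub_center (c C : ℂ) (R θ : ℝ) :
    Complex.normSq (circlePoint c R θ - C) = Complex.normSq (c - C) + R ^ 2 +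
      2 * R * ((c - C).re * Real.cos θ + (c - C).im * Real.sin θ) := by
  simp only [Complex.normSq_apply, Complex.sub_re, Complex.sub_im, circlePoint_re, circlePoint_im]
  linear_combination R ^ 2 * Real.sin_sq_add_cos_sq θ

namespace CcwArc

variable {R : ℝ} {A B : ℂ}

theorem areaIntegral_eq (a : CcwArc R A B) :
    a.areaIntegral = cross A B / 2 + R ^ 2 / 2 *
      (a.endAngle - a.startAngle - Real.sin (a.endAngle - a.startAngle)) := by
  have h : ∫ θ in a.startAngle..a.endAngle,
      cross (circlePoint a.center R θ) (deriv (circlePoint a.center R) θ) =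
      R ^ 2 * (a.endAngle - a.startAngle) + R * (a.center.re * (Real.sin a.endAngle -
        Real.sin a.startAngle) + a.center.im * (Real.cos a.startAngle - Real.cos a.endAngle)) := by
    simp only [cross_circlePoint_deriv]
    rw [intervalIntegral.integral_eq_sub_of_hasDerivAt (f := fun θ => R ^ 2 * θ +
      R * (a.center.re * Real.sin θ - a.center.im * Real.cos θ))]
    · ring
    · intro θ _
      refine (((hasDerivAt_id θ).const_mul (R ^ 2)).add ((((Real.hasDerivAt_sin θ).const_mul
        a.center.re).sub ((Real.hasDerivAt_cos θ).const_mul a.center.im)).const_mul R)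
          ).congr_deriv ?_
      ring
    · exact Continuous.intervalIntegrable (by fun_prop) _ _
  have hAB : cross A B = R * (a.center.re * (Real.sin a.endAngle -
        Real.sin a.startAngle) + a.center.im * (Real.cos a.startAngle - Real.cos a.endAngle)) +
      R ^ 2 * Real.sin (a.endAngle - a.startAngle) := by
    have hA := a.start_eq
    have hB := a.end_eq
    rw [cross_eq, Real.sin_sub]
    simp only [← congrArg Complex.re hA, ← congrArg Complex.im hA, ← congrArg Complex.re hB,
      ← congrArg Complex.im hB, circlePoint_re, circlePoint_im]
    ring
  rw [areaIntegral, h, hAB]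
  ring

theorem value_eq (hR : 0 < R) (a : CcwArc R A B) (h : a.endAngle - a.startAngle < Real.pi) :
    a.length - 1 / R * a.areaIntegral = segmentValue R ‖B - A‖ - cross A B / (2 * R) := by
  have h0 := sub_nonneg.2 a.angle_le
  have hnorm : ‖B - A‖ = 2 * R * Real.sin ((a.endAngle - a.startAngle) / 2) := by
    have h1 := normSq_circlePoint_sub a.center R a.startAngle a.endAngle
    rw [a.start_eq, a.end_eq, Complex.normSq_eq_norm_sq] at h1
    have h2 : 0 ≤ Real.sin ((a.endAngle - a.startAngle) / 2) :=
      Real.sin_nonneg_of_nonneg_of_le_pi (by linarith) (by linarith [Real.pi_pos])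
    exact (pow_left_inj₀ (norm_nonneg _) (by positivity) two_ne_zero).1 h1
  have hdiv : ‖B - A‖ / (2 * R) = Real.sin ((a.endAngle - a.startAngle) / 2) := by
    rw [hnorm]
    field_simp
  have hcos : 0 ≤ Real.cos ((a.endAngle - a.startAngle) / 2) :=
    Real.cos_nonneg_of_neg_pi_div_two_le_of_le (by linarith) (by linarith)
  have hsin := Real.sin_two_mul ((a.endAngle - a.startAngle) / 2)
  rw [mul_div_cancel₀ _ (two_ne_zero' ℝ)] at hsin
  rw [areaIntegral_eq, length, segmentValue, hdiv, Real.arcsin_sin (by linarith) (by linarith),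
    ← Real.cos_sq', Real.sqrt_sq hcos, hsin]
  field_simp
  ring

/-- A short arc lies in every disk of radius `R` that contains its endpoints. -/
theorem normSq_sub_le (a : CcwArc R A B) (h : a.endAngle - a.startAngle < Real.pi)
    {C P : ℂ} (hA : Complex.normSq (A - C) ≤ R ^ 2) (hB : Complex.normSq (B - C) ≤ R ^ 2)
    (hP : P ∈ a.carrier) : Complex.normSq (P - C) ≤ R ^ 2 := by
  obtain ⟨θ, ⟨h1, h2⟩, rfl⟩ := hP
  have hs := a.start_eq
  have he := a.end_eq
  generalize a.startAngle = α at *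
  generalize a.endAngle = β at *
  generalize a.center = c at *
  rcases (h1.trans h2).eq_or_lt with rfl | hlt
  · obtain rfl : α = θ := le_antisymm h1 h2
    rwa [hs]
  rw [← hs, normSq_circlePoint_sub_center] at hA
  rw [← he, normSq_circlePoint_sub_center] at hB
  rw [normSq_circlePoint_sub_center]
  have hS : 0 < Real.sin (β - α) := Real.sin_pos_of_pos_of_lt_pi (by linarith) h
  have ha : 0 ≤ Real.sin (β - θ) :=
    Real.sin_nonneg_of_nonneg_of_le_pi (by linarith) (by linarith)
  have hb : 0 ≤ Real.sin (θ - α) :=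
    Real.sin_nonneg_of_nonneg_of_le_pi (by linarith) (by linarith)
  -- The direction at `θ` is a nonnegative combination of the end directions with coefficient sum at
  -- least 1. As `N ≥ 0`, the affine condition for lying in the disk passes from the ends to `θ`.
  have hab : Real.sin (β - α) ≤ Real.sin (β - θ) + Real.sin (θ - α) := by
    have := Real.sin_add (β - θ) (θ - α)
    rw [sub_add_sub_cancel] at this
    rw [this]
    have c1 := mul_le_mul_of_nonneg_left (Real.cos_le_one (θ - α)) ha
    have c2 := mul_le_mul_of_nonneg_right (Real.cos_le_one (β - θ)) hb
    linarith
  have hcos : Real.sin (β - α) * Real.cos θ =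
      Real.sin (β - θ) * Real.cos α + Real.sin (θ - α) * Real.cos β := by
    simp only [Real.sin_sub]
    ring
  have hsin : Real.sin (β - α) * Real.sin θ =
      Real.sin (β - θ) * Real.sin α + Real.sin (θ - α) * Real.sin β := by
    simp only [Real.sin_sub]
    ring
  have hN := Complex.normSq_nonneg (c - C)
  generalize Complex.normSq (c - C) = N at *
  generalize c - C = e at *
  have k1 := mul_le_mul_of_nonneg_left hA ha
  have k2 := mul_le_mul_of_nonneg_left hB hb
  have k3 := mul_le_mul_of_nonneg_right hab hN
  have k4 : Real.sin (β - α) * (N + 2 * R * (e.re * Real.cos θ + e.im * Real.sin θ)) ≤ 0 := by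
    have : Real.sin (β - α) * (N + 2 * R * (e.re * Real.cos θ + e.im * Real.sin θ)) =
        Real.sin (β - α) * N + 2 * R * (e.re * (Real.sin (β - α) * Real.cos θ)
          + e.im * (Real.sin (β - α) * Real.sin θ)) := by ring
    rw [this, hcos, hsin]
    linarith
  have := nonpos_of_mul_nonpos_right k4 hS
  linarith

/-- Through two points at distance less than `2 * R` there passes a short arc. -/
theorem exists_short (hR : 0 < R) (hAB : ‖B - A‖ < 2 * R) :
    ∃ a : CcwArc R A B, a.endAngle - a.startAngle < Real.pi := by
  set ψ := Real.arcsin (‖B - A‖ / (2 * R)) with hψ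
  have h0 : 0 ≤ ‖B - A‖ / (2 * R) := by positivity
  have h1 : ‖B - A‖ / (2 * R) < 1 := (div_lt_one (by positivity)).2 hAB
  have hsin : Real.sin ψ = ‖B - A‖ / (2 * R) := Real.sin_arcsin (by linarith) h1.le
  have hψ0 : 0 ≤ ψ := Real.arcsin_nonneg.2 h0
  have hψ1 : ψ < Real.pi / 2 := by
    refine lt_of_le_of_ne (Real.arcsin_le_pi_div_two _) fun h => ?_
    rw [h, Real.sin_pi_div_two] at hsin
    linarith
  -- The chord subtends the angle `2 * ψ`, and the radius to the middle of the arc is the chord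
  -- direction turned by `-π / 2`.
  set α := (B - A).arg - Real.pi / 2 - ψ with hα
  refine ⟨⟨A - R * Complex.exp (α * Complex.I), α, α + 2 * ψ, by linarith, ?_, ?_⟩, ?_⟩
  · simp [circlePoint]
  · have hr : 2 * R * Real.sin ψ = ‖B - A‖ := by
      rw [hsin]
      field_simp
    have hre := Complex.norm_mul_cos_arg (B - A)
    have him := Complex.norm_mul_sin_arg (B - A)
    have e1 : α + 2 * ψ = ((B - A).arg - Real.pi / 2) + ψ := by rw [hα]; ring
    apply Complex.ext
    · rw [circlePoint_re, Complex.sub_re, Complex.re_ofReal_mul, Complex.exp_ofReal_mul_I_re, e1,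
        hα, Real.cos_sub _ ψ, Real.cos_add _ ψ, Real.sin_sub_pi_div_two]
      rw [← hr, Complex.sub_re] at hre
      linear_combination hre
    · rw [circlePoint_im, Complex.sub_im, Complex.im_ofReal_mul, Complex.exp_ofReal_mul_I_im, e1,
        hα, Real.sin_sub _ ψ, Real.sin_add _ ψ, Real.cos_sub_pi_div_two]
      rw [← hr, Complex.sub_im] at him
      linear_combination him
  · simp only
    linarith

end CcwArc

namespace IsOval

variable {γ : ℝ → ℂ} {L R : ℝ} (hγ : IsOval γ L)

include hγ

/-- A longer arc contains two antipodal points, at distance `2 * R`, while the table has smaller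
diameter. -/
theorem angle_lt_pi (hk : ∀ s, 1 / R < curvature γ s) (hR : 0 < R) {A B : ℂ} (a : CcwArc R A B)
    (ha : a.carrier ⊆ table γ) : a.endAngle - a.startAngle < Real.pi := by
  by_contra! hge
  have hpi := Real.pi_pos
  have h1 : circlePoint a.center R a.startAngle ∈ table γ :=
    ha ⟨_, ⟨le_rfl, a.angle_le⟩, rfl⟩
  have h2 : circlePoint a.center R (a.startAngle + Real.pi) ∈ table γ :=
    ha ⟨_, ⟨by linarith, by linarith⟩, rfl⟩
  obtain ⟨_, ⟨s, rfl⟩, _, ⟨t, rfl⟩, hst⟩ := convexHull_exists_dist_ge2 h2 h1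
  have h3 := normSq_circlePoint_sub a.center R a.startAngle (a.startAngle + Real.pi)
  rw [add_sub_cancel_left, Real.sin_pi_div_two, mul_one, Complex.normSq_eq_norm_sq] at h3
  have h4 := (pow_left_inj₀ (norm_nonneg _) (by positivity) two_ne_zero).1 h3
  rw [dist_eq_norm, dist_eq_norm, h4] at hst
  exact absurd (hγ.dist_lt hk hR t s) (not_lt.2 hst)

/-- A point of the arc outside the table would lie strictly to the right of some tangent of the
oval. But the disk of radius `R` touching the oval there contains the oval, hence the short arc, and
lies to the left. -/
theorem carrier_subset (hk : ∀ s, 1 / R < curvature γ s) (hR : 0 < R) {s t : ℝ}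
    (a : CcwArc R (γ s) (γ t)) (ha : a.endAngle - a.startAngle < Real.pi) :
    a.carrier ⊆ table γ := by
  intro P hP
  by_contra hPt
  obtain ⟨f, u, hfu, huP⟩ := geometric_hahn_banach_closed_point (convex_convexHull ℝ (Set.range γ))
    (isCompact_convexHull hγ.isCompact_range).isClosed hPt
  obtain ⟨_, ⟨τ, rfl⟩, hmax⟩ := hγ.isCompact_range.exists_isMaxOn ⟨_, 0, rfl⟩
    f.continuous.continuousOn
  replace hmax : ∀ σ, f (γ σ) ≤ f (γ τ) := fun σ => hmax ⟨σ, rfl⟩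
  have hτP : f (γ τ) < f P :=
    (hfu _ (subset_convexHull ℝ _ ⟨τ, rfl⟩)).trans huP
  have hfT : f (deriv γ τ) = 0 :=
    IsLocalMax.hasDerivAt_eq_zero (f := fun σ => f (γ σ)) (Filter.Eventually.of_forall hmax)
      (f.hasFDerivAt.comp_hasDerivAt τ (hγ.hasDerivAt τ))
  have hT := hγ.normSq_deriv τ
  have hf : ∀ z, f z = cross (deriv γ τ) z * f (Complex.I * deriv γ τ) := by
    intro z
    have hz : z = dot (deriv γ τ) z • deriv γ τ + cross (deriv γ τ) z • (Complex.I * deriv γ τ) := by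
      rw [Complex.normSq_apply] at hT
      apply Complex.ext
      · simp [dot, cross_eq]
        linear_combination (-z.re) * hT
      · simp [dot, cross_eq]
        linear_combination (-z.im) * hT
    conv_lhs => rw [hz]
    rw [map_add, map_smul, map_smul, hfT, smul_zero, zero_add, smul_eq_mul]
  have hneg : f (Complex.I * deriv γ τ) ≤ 0 := by
    have hL := hγ.length_pos
    have hc := hγ.strictly_convex τ (τ + L / 2)
      (hγ.ne_of_lt (by linarith) (by linarith))
    have h1 := hmax (τ + L / 2)
    rw [← sub_nonpos, ← map_sub, hf] at h1
    exact nonpos_of_mul_nonpos_right h1 hc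
  have hcross : cross (deriv γ τ) (P - γ τ) < 0 := by
    rw [← sub_pos, ← map_sub, hf] at hτP
    by_contra! hge
    exact absurd hτP (not_lt.2 (mul_nonpos_of_nonneg_of_nonpos hge hneg))
  set C : ℂ := γ τ + R * (Complex.I * deriv γ τ) with hC
  have hm : ∀ z, Complex.normSq (z - C) = Complex.normSq (z - γ τ)
      - 2 * R * cross (deriv γ τ) (z - γ τ) + R ^ 2 := by
    intro z
    simp only [hC, cross_eq, Complex.normSq_apply, Complex.sub_re, Complex.sub_im,
      Complex.add_re, Complex.add_im, Complex.mul_re, Complex.mul_im, Complex.I_re, Complex.I_im,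
      Complex.ofReal_re, Complex.ofReal_im] at hT ⊢
    linear_combination R ^ 2 * hT
  have hin : ∀ σ, Complex.normSq (γ σ - C) ≤ R ^ 2 := by
    intro σ
    rw [hm]
    by_cases hne : γ σ = γ τ
    · simp [hne, cross_eq]
    · linarith [hγ.normSq_lt hk hR hne]
  have hPC := a.normSq_sub_le ha (hin s) (hin t) hP
  rw [hm] at hPC
  have := mul_neg_of_pos_of_neg (mul_pos two_pos hR) hcross
  linarith [Complex.normSq_nonneg (P - γ τ)]

theorem exists_side (hk : ∀ s, 1 / R < curvature γ s) (hR : 0 < R) (s t : ℝ) :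
    ∃ a : CcwArc R (γ s) (γ t), a.carrier ⊆ table γ :=
  let ⟨a, ha⟩ := CcwArc.exists_short hR (hγ.dist_lt hk hR s t)
  ⟨a, hγ.carrier_subset hk hR a ha⟩

theorem actionValues_eq (hk : ∀ s, 1 / R < curvature γ s) (hR : 0 < R) (p n : ℕ) :
    actionValues γ L R p n = {v | ∃ x, IsPath L p n x ∧ action (generating γ R) n x = v} := by
  have hval : ∀ P : InscribedPolygon γ L R p n, P.perimeter - 1 / R * P.enclosedArea =
      ∑ i : Fin n, generating γ R (P.x i.castSucc) (P.x i.succ) := by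
    intro P
    rw [InscribedPolygon.perimeter, InscribedPolygon.enclosedArea, Finset.mul_sum,
      ← Finset.sum_sub_distrib]
    exact Finset.sum_congr rfl fun i _ =>
      (P.side i).value_eq hR (hγ.angle_lt_pi hk hR _ (P.side_subset i))
  apply Set.Subset.antisymm
  · rintro _ ⟨P, rfl⟩
    -- `Fin.ofNat` reduces modulo `n + 1`, which is harmless as only indices up to `n` are used.
    have hcast : ∀ i : Fin n, Fin.ofNat (n + 1) i = i.castSucc := fun i => by
      ext
      simp
    have hsucc : ∀ i : Fin n, Fin.ofNat (n + 1) (i + 1) = i.succ := fun i => by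
      ext
      simp [Nat.mod_eq_of_lt (Nat.succ_lt_succ i.2)]
    refine ⟨fun i => P.x (Fin.ofNat (n + 1) i), ⟨fun i hi => ?_, fun i hi => ?_, ?_⟩, ?_⟩
    · have := P.step_nonneg ⟨i, hi⟩
      rwa [← hcast, ← hsucc] at this
    · have := P.step_le ⟨i, hi⟩
      rwa [← hcast, ← hsucc] at this
    · have h1 : Fin.ofNat (n + 1) n = Fin.last n := by ext; simp
      have h2 : Fin.ofNat (n + 1) 0 = 0 := by ext; simp
      rw [h1, h2]
      exact P.closes
    · simp only [hval]
      rw [action, ← Fin.sum_univ_eq_sum_range (fun i => generating γ R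
        (P.x (Fin.ofNat (n + 1) i)) (P.x (Fin.ofNat (n + 1) (i + 1))))]
      simp only [hcast, hsucc]
  · rintro _ ⟨x, hx, rfl⟩
    choose side hside using fun i : Fin n => hγ.exists_side hk hR (x i) (x (i + 1))
    refine ⟨⟨fun i => x i, fun i => hx.le i i.2, fun i => hx.le_add i i.2, by simpa using hx.closes,
      side, hside⟩, ?_⟩
    simp only [hval]
    rw [action, ← Fin.sum_univ_eq_sum_range (fun i => generating γ R (x i) (x (i + 1)))]
    rfl

theorem isGreatest_action (hk : ∀ s, 1 / R < curvature γ s) (hR : 0 < R) {p n : ℕ} {x : ℕ → ℝ}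
    (hx : IsMaximizer (generating γ R) L p n x) :
    IsGreatest (actionValues γ L R p n) (action (generating γ R) n x) := by
  rw [hγ.actionValues_eq hk hR]
  refine ⟨⟨x, hx.1.isPath, rfl⟩, ?_⟩
  rintro _ ⟨y, hy, rfl⟩
  exact hx.2 y hy

end IsOval

end MagneticBilliard

end

theorem mainTheorem9 (γ : ℝ → ℂ) (L R : ℝ) (hγ : MagneticBilliard.IsOval γ L)
    (hR : 0 < R) (hweak : 1 / R < MagneticBilliard.curvatureMin γ)
    (p q : ℕ) (hp : 0 < p) (hpq : p < q) :
    IsGreatest (MagneticBilliard.actionValues γ L R p (q - 1))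
        (MagneticBilliard.M γ L R p (q - 1)) ∧
      IsGreatest (MagneticBilliard.actionValues γ L R p q)
        (MagneticBilliard.M γ L R p q) ∧
      IsGreatest (MagneticBilliard.actionValues γ L R p (q + 1))
        (MagneticBilliard.M γ L R p (q + 1)) ∧
      MagneticBilliard.M γ L R p (q - 1) + MagneticBilliard.M γ L R p (q + 1)
        < 2 * MagneticBilliard.M γ L R p q := by
  have hk := MagneticBilliard.IsOval.curvature_gt hR hweak
  have hH := hγ.isTwistGenerating hk hR
  -- Here `0 < p < q` gives `1 ≤ q - 1` and `p ≤ q - 1`, so the truncated subtraction is genuine.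
  obtain ⟨x, hx⟩ := hH.exists_isMaximizer (p := p) (n := q - 1) (by omega) (by omega)
  obtain ⟨w, hw⟩ := hH.exists_isMaximizer (p := p) (n := q) (by omega) (by omega)
  obtain ⟨y, hy⟩ := hH.exists_isMaximizer (p := p) (n := q + 1) (by omega) (by omega)
  have gx := hγ.isGreatest_action hk hR hx
  have gw := hγ.isGreatest_action hk hR hw
  have gy := hγ.isGreatest_action hk hR hy
  have ex : MagneticBilliard.M γ L R p (q - 1) = _ := gx.csSup_eq
  have ew : MagneticBilliard.M γ L R p q = _ := gw.csSup_eq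
  have ey : MagneticBilliard.M γ L R p (q + 1) = _ := gy.csSup_eq
  rw [ex, ew, ey]
  exact ⟨gx, gw, gy, hH.action_add_lt hp hpq hx hw hy⟩
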